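/- **Conventions.** Semigroups of coefficients are commutative and written multiplicatively unless said otherwise. In an inverse semigroup $S$ (every $s$ has a unique $s^{-1}$ with $ss^{-1}s=s$, $s^{-1}ss^{-1}=s^{-1}$), $E(S)$ is the commutative set of idempotents and $s\le t$ means $s=et$ for some $e\in E(S)$. *Partial modules.* Let $G$ be a group. A partial $G$-module is a commutative monoid $A$ with idempotents $1_x$ $(x\in G)$ and isomorphisms $\theta_x:A_{x^{-1}}\to A_x$, where $A_x=1_xA$, such that $A_1=A$, $\theta_1=\mathrm{id}$, $\theta_x(A_{x^{-1}}\cap A_y)=A_x\cap A_{xy}$, and $\theta_x\theta_y(a)=\theta_{xy}(a)$ for $a\in A_{y^{-1}}\cap A_{y^{-1}x^{-1}}$. It is inverse if $A$ is an inverse semigroup and $E(A)$ is generated by the $1_x$. For $n\ge 0$, $C^n(G,A)$ is the abelian group (under pointwise multiplication) of functions $f$ on $G^n$ such that $f(x_1,\dots,x_n)$ is an invertible element of the ideal $1_{x_1}1_{x_1x_2}\cdots1_{x_1\cdots x_n}A$ (so $C^0(G,A)$ is the group of units of $A$), and $$(\delta^nf)(x_1,\dots,x_{n+1})=\theta_{x_1}(1_{x_1^{-1}}f(x_2,\dots,x_{n+1}))\prod_{i=1}^nf(x_1,\dots,x_ix_{i+1},\dots,x_{n+1})^{(-1)^i}f(x_1,\dots,x_n)^{(-1)^{n+1}},$$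 where for $n=0$ this reads $(\delta^0a)(x)=\theta_x(1_{x^{-1}}a)a^{-1}$. Then $H^n(G,A)=\ker\delta^n/\operatorname{im}\delta^{n-1}$, with $\operatorname{im}\delta^{-1}$ trivial. *Modules over inverse monoids.* Let $S$ be an inverse monoid. An $S$-module is a commutative monoid $A$ with monoid homomorphisms $\lambda:S\to\operatorname{End}A$ (semigroup endomorphisms) and $\alpha:E(S)\to E(A)$ such that $\lambda_e(a)=\alpha(e)a$ and $\lambda_s(\alpha(e))=\alpha(ses^{-1})$. It is strict inverse if $A$ is inverse and $\alpha$ is bijective; then $A$ is the disjoint union of the abelian groups $A_e=\{a:aa^{-1}=\alpha(e)\}$, $e\in E(S)$. A morphism is a semigroup homomorphism $\varphi$ with $\varphi\alpha=\alpha'$ and $\varphi\lambda_s=\lambda'_s\varphi$; its kernel is $\bigcup_e\varphi^{-1}(\alpha'(e))$. Strict inverse $S$-modules form an abelian category; $\operatorname{Ext}_S$ denotes its $\operatorname{Ext}$. The module $\mathbb Z_S$ has $(\mathbb Z_S)_e=\{n_e:n\in\mathbb Z\}$, $n_e+m_f=(n+m)_{ef}$, $\lambda_s(n_e)=n_{ses^{-1}}$,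 $\alpha(e)=0_e$. Let $T$ be an inverse monoid. An inverse epi-strict $T$-module is a pair $(A,\pi)$ of an epimorphism $\pi:T\to S$ onto an inverse monoid and a strict inverse $S$-module $A$ ($A$ is then called $\pi$-strict). A morphism $(A',\pi':T\to S')\to(A'',\pi'':T\to S'')$ is a pair $(\varphi,\psi)$ of homomorphisms $\varphi:A'\to A''$, $\psi:S'\to S''$ with $\psi\pi'=\pi''$, $\varphi\alpha'=\alpha''\psi$ on $E(S')$ and $\varphi\lambda'_s=\lambda''_{\psi(s)}\varphi$. An epi-strict $E(T)$-set is such a $\pi$ with a disjoint union $X=\bigsqcup_{e\in E(S)}X_e$ of sets; its morphisms are pairs $(\varphi,\psi)$ of a map and a homomorphism with $\psi\pi'=\pi''$ and $\varphi(X'_e)\subseteq X''_{\psi(e)}$. The cohomology of $T$ with values in $(A,\pi:T\to S)$ is $H^n(T,A)=\operatorname{Ext}^n_S(\mathbb Z_S,A)$. For a $T$-module $(B,\lambda,\alpha)$ with $\alpha$ surjective, $B\rtimes T$ is the quotient of the semigroup of symbols $b\delta_t$ $(t\in T,\ b\in\alpha(tt^{-1})B)$, with $b\delta_t\cdot c\delta_u=b\lambda_t(c)\delta_{tu}$,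 by the congruence generated by all pairs $(b\delta_t,b\delta_u)$ with $t\le u$. Let $S'$ be the image of the homomorphism $\pi':T\to B\rtimes T$, $t\mapsto[\alpha(tt^{-1})\delta_t]$. Then $B$ is a strict $S'$-module by $\lambda'\pi'=\lambda$, $\alpha'\pi'=\alpha$. An epi-strict $T$-module is standard if it is isomorphic to one obtained in this way. *Exel's monoid.* $\mathcal S(G)$ is generated by symbols $[x]$, $x\in G$, with relations $[x^{-1}][x][y]=[x^{-1}][xy]$, $[x][y][y^{-1}]=[xy][y^{-1}]$, $[x][1]=[x]$; it is an inverse monoid with $[x]^{-1}=[x^{-1}]$. An inverse epi-strict $\mathcal S(G)$-module $(A,\pi:\mathcal S(G)\to S)$ induces the partial $G$-module $(A,\theta)$ if $\alpha(\pi([x][x^{-1}]))=1_x$ and $\lambda_{\pi([x])}(a)=\theta_x(1_{x^{-1}}a)$ for all $x\in G$, $a\in A$. *The resolution.* Given an epimorphism $\pi:\mathcal S(G)\to S$ onto an inverse monoid, put $\Gamma(x)=\pi([x])$, $\epsilon_x=\Gamma(x)\Gamma(x)^{-1}$ and $\epsilon_{(x_1,\dots,x_n)}=\epsilon_{x_1}\epsilon_{x_1x_2}\cdots\epsilon_{x_1\cdots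 x_n}$ (equal to $1_S$ for $n=0$). Let $V_n=G^n$, with $(x_1,\dots,x_n)$ in the component of index $\epsilon_{(x_1,\dots,x_n)}$. Let $R_n$ be the strict inverse $S$-module, written additively, whose component $(R_n)_e$ is the free abelian group on the pairs $(s,v)$ with $s\in S$, $v\in V_n$ in the component of index $f$, $ss^{-1}=e$ and $s^{-1}s\le f$, with $\lambda_s(t,v)=(st,v)$, the sum of $a\in(R_n)_e$ and $b\in(R_n)_f$ being $\lambda_f(a)+\lambda_e(b)\in(R_n)_{ef}$, and $\alpha(e)$ the zero of $(R_n)_e$. Let $\iota_n:V_n\to R_n$, $\iota_n(v)=(\epsilon_v,v)$. Let $\partial_n:R_n\to R_{n-1}$ $(n\ge1)$ and $\partial_0:R_0\to\mathbb Z_S$ be the morphisms determined by (writing $v$ for $\iota_n(v)$) $$\partial_n(x_1,\dots,x_n)=(\Gamma(x_1)\epsilon_{(x_2,\dots,x_n)},(x_2,\dots,x_n))+\sum_{i=1}^{n-1}(-1)^i(\epsilon_{(x_1,\dots,x_n)},(x_1,\dots,x_ix_{i+1},\dots,x_n))+(-1)^n(\epsilon_{(x_1,\dots,x_n)},(x_1,\dots,x_{n-1})),$$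 for $n=1$: $\partial_1(x)=(\Gamma(x),(\,))-(\epsilon_x,(\,))$, and $\partial_0(\,)=1_{1_S}$. **Theorem.** Let $(A,\theta)$ be an inverse partial $G$-module and let $(A,\pi:\mathcal S(G)\to S)$ be a standard inverse $\pi$-strict $\mathcal S(G)$-module inducing $(A,\theta)$. Then: 1. For every $n\ge0$, $(R_n,\pi)$ is free over $V_n$ in the category of inverse epi-strict $\mathcal S(G)$-modules: every morphism of epi-strict $E(\mathcal S(G))$-sets from $V_n$ to an inverse epi-strict $\mathcal S(G)$-module extends uniquely along $\iota_n$ to a morphism of modules from $R_n$. 2. The sequence $\cdots\xrightarrow{\partial_2}R_1\xrightarrow{\partial_1}R_0\xrightarrow{\partial_0}\mathbb Z_S\to0$ is exact; thus it is a free resolution of $\mathbb Z_S$. 3. The maps $f\mapsto f\circ\iota_n$ are isomorphisms of groups $\operatorname{Hom}_S(R_n,A)\cong C^n(G,A)$ for $n\ge0$, and they take $f\circ\partial_{n+1}$ to $\delta^n(f\circ\iota_n)$. 4. Consequently the $n$-th cohomology group of the complex $\operatorname{Hom}_S(R_\bullet,A)$ is isomorphic to $H^n(G,A)$ for all $n\ge0$.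 5. $H^n(G,A)\cong H^n(\mathcal S(G),A)=\operatorname{Ext}^n_S(\mathbb Z_S,A)$ for all $n\ge0$. -/

import Mathlib

open CategoryTheory

universe u

noncomputable section

namespace PartialCohomology

/-! ### Inverse semigroups and their idempotents -/

/-- A semigroup is inverse if every `s` has a unique `t` with `s t s = s` and `t s t = t`. -/
class IsInverseSemigroup (S : Type*) [Semigroup S] : Prop where
  existsUnique_inv : ∀ s : S, ∃! t : S, s * t * s = s ∧ t * s * t = t

/-- The inverse `s⁻¹` of an element of an inverse semigroup. -/
def sinv {S : Type*} [Semigroup S] [IsInverseSemigroup S] (s : S) : S :=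
  (IsInverseSemigroup.existsUnique_inv s).choose

section Inverse

variable {S : Type*} [Semigroup S]

theorem sinv_spec [IsInverseSemigroup S] (s : S) :
    s * sinv s * s = s ∧ sinv s * s * sinv s = sinv s :=
  (IsInverseSemigroup.existsUnique_inv s).choose_spec.1

theorem mul_sinv_mul [IsInverseSemigroup S] (s : S) : s * sinv s * s = s := (sinv_spec s).1

theorem sinv_mul_sinv [IsInverseSemigroup S] (s : S) : sinv s * s * sinv s = sinv s :=
  (sinv_spec s).2

theorem eq_sinv [IsInverseSemigroup S] {s t : S} (h₁ : s * t * s = s) (h₂ : t * s * t = t) :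
    t = sinv s :=
  (IsInverseSemigroup.existsUnique_inv s).choose_spec.2 t ⟨h₁, h₂⟩

/-- The semigroup has commuting idempotents. -/
class IdemComm (S : Type*) [Semigroup S] : Prop where
  comm : ∀ e f : S, e * e = e → f * f = f → e * f = f * e

instance (S : Type*) [CommSemigroup S] : IdemComm S := ⟨fun e f _ _ => mul_comm e f⟩

instance [IsInverseSemigroup S] : IdemComm S := by
  have key : ∀ e f : S, e * e = e → f * f = f → (e * f) * (e * f) = e * f := by
    intro e f he hf
    obtain ⟨h₁, h₂⟩ := sinv_spec (e * f)
    have hx : f * sinv (e * f) * e = sinv (e * f) := by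
      apply eq_sinv
      · calc e * f * (f * sinv (e * f) * e) * (e * f)
            = e * (f * f) * sinv (e * f) * (e * e) * f := by simp only [mul_assoc]
          _ = e * f * sinv (e * f) * (e * f) := by rw [he, hf]; simp only [mul_assoc]
          _ = e * f := h₁
      · calc f * sinv (e * f) * e * (e * f) * (f * sinv (e * f) * e)
            = f * sinv (e * f) * (e * e) * (f * f) * sinv (e * f) * e := by
              simp only [mul_assoc]
          _ = f * (sinv (e * f) * (e * f) * sinv (e * f)) * e := by
              rw [he, hf]; simp only [mul_assoc]
          _ = f * sinv (e * f) * e := by rw [h₂]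
    have hxx : sinv (e * f) * sinv (e * f) = sinv (e * f) := by
      calc sinv (e * f) * sinv (e * f)
          = (f * sinv (e * f) * e) * (f * sinv (e * f) * e) := by rw [hx]
        _ = f * (sinv (e * f) * (e * f) * sinv (e * f)) * e := by simp only [mul_assoc]
        _ = sinv (e * f) := by rw [h₂, hx]
    have h3 : e * f = sinv (sinv (e * f)) := eq_sinv h₂ h₁
    have h4 : sinv (e * f) = sinv (sinv (e * f)) := by
      apply eq_sinv <;> rw [hxx, hxx]
    rw [h3, ← h4, hxx]
  refine ⟨fun e f he hf => ?_⟩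
  have h1 := key e f he hf
  have h2 := key f e hf he
  have h3 : e * f = sinv (e * f) := eq_sinv (by rw [h1, h1]) (by rw [h1, h1])
  have h4 : f * e = sinv (e * f) := by
    apply eq_sinv
    · calc e * f * (f * e) * (e * f) = e * (f * f) * (e * e) * f := by simp only [mul_assoc]
        _ = e * f * (e * f) := by rw [he, hf]; simp only [mul_assoc]
        _ = e * f := h1
    · calc f * e * (e * f) * (f * e) = f * (e * e) * (f * f) * e := by simp only [mul_assoc]
        _ = f * e * (f * e) := by rw [he, hf]; simp only [mul_assoc]
        _ = f * e := h2
  rw [h4, ← h3]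

theorem IsInverseSemigroup.of_regular [IdemComm S]
    (h : ∀ s : S, ∃ t : S, s * t * s = s ∧ t * s * t = t) : IsInverseSemigroup S := by
  refine ⟨fun s => ?_⟩
  obtain ⟨t, h₁, h₂⟩ := h s
  refine ⟨t, ⟨h₁, h₂⟩, ?_⟩
  rintro t' ⟨h₁', h₂'⟩
  have i1 : (s * t) * (s * t) = s * t := by rw [← mul_assoc, h₁]
  have i2 : (s * t') * (s * t') = s * t' := by rw [← mul_assoc, h₁']
  have i3 : (t * s) * (t * s) = t * s := by rw [← mul_assoc, h₂]
  have i4 : (t' * s) * (t' * s) = t' * s := by rw [← mul_assoc, h₂']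
  have e1 : t = t * s * t' := by
    calc t = t * (s * t' * s) * t := by rw [h₁', h₂]
      _ = t * ((s * t') * (s * t)) := by simp only [mul_assoc]
      _ = t * ((s * t) * (s * t')) := by rw [IdemComm.comm _ _ i2 i1]
      _ = (t * s * t) * s * t' := by simp only [mul_assoc]
      _ = t * s * t' := by rw [h₂]
  have e2 : t' = t * s * t' := by
    calc t' = t' * (s * t * s) * t' := by rw [h₁, h₂']
      _ = ((t' * s) * (t * s)) * t' := by simp only [mul_assoc]
      _ = ((t * s) * (t' * s)) * t' := by rw [IdemComm.comm _ _ i4 i3]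
      _ = t * s * (t' * s * t') := by simp only [mul_assoc]
      _ = t * s * t' := by rw [h₂']
  rw [e2, ← e1]

theorem map_sinv {T : Type*} [Semigroup T] [IsInverseSemigroup S] [IsInverseSemigroup T]
    {F : Type*} [FunLike F S T] [MulHomClass F S T] (φ : F) (s : S) :
    φ (sinv s) = sinv (φ s) := by
  apply eq_sinv
  · rw [← map_mul, ← map_mul, mul_sinv_mul]
  · rw [← map_mul, ← map_mul, sinv_mul_sinv]

theorem sinv_idem [IsInverseSemigroup S] {e : S} (he : e * e = e) : sinv e = e :=
  (eq_sinv (by rw [he, he]) (by rw [he, he])).symm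

theorem mul_sinv_idem [IsInverseSemigroup S] (s : S) :
    (s * sinv s) * (s * sinv s) = s * sinv s := by rw [← mul_assoc, mul_sinv_mul]

theorem sinv_mul_idem [IsInverseSemigroup S] (s : S) :
    (sinv s * s) * (sinv s * s) = sinv s * s := by rw [← mul_assoc, sinv_mul_sinv]

theorem sinv_mul [IsInverseSemigroup S] (s t : S) : sinv (s * t) = sinv t * sinv s := by
  symm
  have hc := IdemComm.comm _ _ (sinv_mul_idem s) (mul_sinv_idem t)
  apply eq_sinv
  · calc s * t * (sinv t * sinv s) * (s * t)
        = s * ((t * sinv t) * (sinv s * s)) * t := by simp only [mul_assoc]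
      _ = (s * sinv s * s) * (t * sinv t * t) := by rw [← hc]; simp only [mul_assoc]
      _ = s * t := by rw [mul_sinv_mul, mul_sinv_mul]
  · calc sinv t * sinv s * (s * t) * (sinv t * sinv s)
        = sinv t * ((sinv s * s) * (t * sinv t)) * sinv s := by simp only [mul_assoc]
      _ = (sinv t * t * sinv t) * (sinv s * s * sinv s) := by rw [hc]; simp only [mul_assoc]
      _ = sinv t * sinv s := by rw [sinv_mul_sinv, sinv_mul_sinv]

end Inverse

/-- The set `E(S)` of idempotents. -/
@[ext] structure Idem (S : Type*) [Semigroup S] where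
  val : S
  mul_self_val : val * val = val

namespace Idem

variable {S T : Type*}

instance [Semigroup S] : CoeOut (Idem S) S := ⟨Idem.val⟩

instance [Monoid S] [IdemComm S] : CommMonoid (Idem S) where
  mul e f := ⟨e.1 * f.1, by
    rw [mul_assoc, ← mul_assoc f.1, IdemComm.comm f.1 e.1 f.2 e.2, mul_assoc, f.2, ← mul_assoc,
      e.2]⟩
  one := ⟨1, mul_one 1⟩
  mul_assoc a b c := Idem.ext (mul_assoc a.1 b.1 c.1)
  one_mul a := Idem.ext (one_mul a.1)
  mul_one a := Idem.ext (mul_one a.1)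
  mul_comm a b := Idem.ext (IdemComm.comm a.1 b.1 a.2 b.2)

@[simp] theorem coe_mul [Monoid S] [IdemComm S] (e f : Idem S) :
    ((e * f : Idem S) : S) = (e : S) * f := rfl

@[simp] theorem coe_one [Monoid S] [IdemComm S] : ((1 : Idem S) : S) = 1 := rfl

theorem mul_self [Monoid S] [IdemComm S] (e : Idem S) : e * e = e := Idem.ext e.2

/-- The map `E(S) → E(T)` induced by a homomorphism `S → T`. -/
def map [Monoid S] [IdemComm S] [Monoid T] [IdemComm T] (φ : S →* T) : Idem S →* Idem T where
  toFun e := ⟨φ e, by rw [← map_mul, e.2]⟩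
  map_one' := Idem.ext (map_one φ)
  map_mul' e f := Idem.ext (map_mul φ e.1 f.1)

@[simp] theorem coe_map [Monoid S] [IdemComm S] [Monoid T] [IdemComm T] (φ : S →* T)
    (e : Idem S) : ((map φ e : Idem T) : T) = φ e := rfl

end Idem

/-- The idempotent `s s⁻¹`. -/
def rIdem {S : Type*} [Semigroup S] [IsInverseSemigroup S] (s : S) : Idem S :=
  ⟨s * sinv s, mul_sinv_idem s⟩

/-- The idempotent `s e s⁻¹`. -/
def conj {S : Type*} [Semigroup S] [IsInverseSemigroup S] (s : S) (e : Idem S) : Idem S :=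
  ⟨s * e * sinv s, by
    calc s * e.1 * sinv s * (s * e.1 * sinv s)
        = s * (e.1 * (sinv s * s)) * (e.1 * sinv s) := by simp only [mul_assoc]
      _ = s * ((sinv s * s) * e.1) * (e.1 * sinv s) := by
          rw [IdemComm.comm _ _ e.2 (sinv_mul_idem s)]
      _ = (s * sinv s * s) * (e.1 * e.1) * sinv s := by simp only [mul_assoc]
      _ = s * e.1 * sinv s := by rw [mul_sinv_mul, e.2]⟩

@[simp] theorem coe_rIdem {S : Type*} [Semigroup S] [IsInverseSemigroup S] (s : S) :
    (rIdem s : S) = s * sinv s := rfl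

@[simp] theorem coe_conj {S : Type*} [Semigroup S] [IsInverseSemigroup S] (s : S) (e : Idem S) :
    (conj s e : S) = s * e * sinv s := rfl

section

variable {S : Type*} [Monoid S] [IsInverseSemigroup S]

theorem conj_idem (f e : Idem S) : conj (f : S) e = f * e := by
  ext
  rw [coe_conj, sinv_idem f.2, mul_assoc, IdemComm.comm _ _ e.2 f.2, ← mul_assoc, f.2]
  rfl

theorem conj_one (e : Idem S) : conj (1 : S) e = e := by
  have := conj_idem (1 : Idem S) e
  rwa [one_mul] at this

theorem conj_mul (s t : S) (e : Idem S) : conj (s * t) e = conj s (conj t e) := by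
  ext
  simp only [coe_conj, sinv_mul, mul_assoc]

theorem conj_eq_rIdem {s : S} {e : Idem S} (h : s * e = s) : conj s e = rIdem s := by
  ext
  rw [coe_conj, h, coe_rIdem]

theorem conj_mul_idem (s : S) (e f : Idem S) : conj s (e * f) = conj s e * conj s f := by
  ext
  calc s * (e.1 * f.1) * sinv s = (s * sinv s * s) * (e.1 * f.1) * sinv s := by
        rw [mul_sinv_mul]
    _ = s * ((sinv s * s) * e.1) * (f.1 * sinv s) := by simp only [mul_assoc]
    _ = s * e.1 * sinv s * (s * f.1 * sinv s) := by
        rw [IdemComm.comm _ _ (sinv_mul_idem s) e.2]; simp only [mul_assoc]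

theorem rIdem_idem (e : Idem S) : rIdem (e : S) = e := by
  ext
  rw [coe_rIdem, sinv_idem e.2, e.2]

theorem rIdem_mul_self (s : S) : (rIdem s : S) * s = s := mul_sinv_mul s

end

/-! ### Unital ideals of a commutative monoid -/

section UnitalIdeal

variable {A B : Type*} [CommMonoid A] [CommMonoid B]

/-- The ideal `e A` generated by an idempotent `e`; it consists of all `a` with `e a = a`. -/
def unitalIdeal (e : Idem A) : Subsemigroup A where
  carrier := {a | (e : A) * a = a}
  mul_mem' {a b} ha _ := by
    change (e : A) * (a * b) = a * b
    rw [← mul_assoc, show (e : A) * a = a from ha]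

theorem mem_unitalIdeal {e : Idem A} {a : A} : a ∈ unitalIdeal e ↔ (e : A) * a = a := Iff.rfl

/-- The ideal `e A` is a monoid with identity element `e`. -/
instance (e : Idem A) : CommMonoid (unitalIdeal e) :=
  { (inferInstance : CommSemigroup (unitalIdeal e)) with
    one := ⟨e, e.2⟩
    one_mul := fun a => Subtype.ext a.2
    mul_one := fun a => Subtype.ext ((mul_comm _ _).trans a.2) }

@[simp] theorem coe_one_unitalIdeal (e : Idem A) : ((1 : unitalIdeal e) : A) = e := rfl

@[simp] theorem coe_mul_unitalIdeal (e : Idem A) (a b : unitalIdeal e) :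
    ((a * b : unitalIdeal e) : A) = a * b := rfl

/-- A homomorphism of semigroups `φ` with `φ e = f` restricts to a monoid homomorphism
`e A → f B`. -/
def idealMap (φ : A →ₙ* B) {e : Idem A} {f : Idem B} (h : φ e = f) :
    unitalIdeal e →* unitalIdeal f where
  toFun a := ⟨φ a, by rw [mem_unitalIdeal, ← h, ← map_mul, a.2]⟩
  map_one' := Subtype.ext h
  map_mul' a b := Subtype.ext (map_mul φ a.1 b.1)

@[simp] theorem coe_idealMap (φ : A →ₙ* B) {e : Idem A} {f : Idem B} (h : φ e = f)
    (a : unitalIdeal e) : (idealMap φ h a : B) = φ a := rfl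

/-- Multiplication by an idempotent. -/
def mulIdem (e : Idem A) : A →ₙ* A where
  toFun a := e * a
  map_mul' a b := by
    rw [mul_mul_mul_comm, e.2]

@[simp] theorem mulIdem_apply (e : Idem A) (a : A) : mulIdem e a = e * a := rfl

/-- The underlying element of `A` of a unit of `e A`. -/
def uval {e : Idem A} (x : (unitalIdeal e)ˣ) : A := (x.val : A)

theorem uval_injective {e : Idem A} : Function.Injective (uval (e := e)) :=
  fun _ _ h => Units.ext (Subtype.ext h)

@[simp] theorem uval_one {e : Idem A} : uval (1 : (unitalIdeal e)ˣ) = e := rfl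

@[simp] theorem uval_mul {e : Idem A} (x y : (unitalIdeal e)ˣ) :
    uval (x * y) = uval x * uval y := rfl

theorem idem_mul_uval {e : Idem A} (x : (unitalIdeal e)ˣ) : (e : A) * uval x = uval x := x.val.2

/-- An element `a` of an inverse commutative monoid is a unit of the ideal generated by
`a a⁻¹`. -/
def toUnit [IsInverseSemigroup A] (a : A) {e : Idem A} (h : rIdem a = e) :
    (unitalIdeal e)ˣ where
  val := ⟨a, by rw [mem_unitalIdeal, ← h]; exact mul_sinv_mul a⟩
  inv := ⟨sinv a, by
    rw [mem_unitalIdeal, ← h, coe_rIdem, mul_comm a, sinv_mul_sinv]⟩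
  val_inv := Subtype.ext (congrArg Idem.val h)
  inv_val := Subtype.ext ((mul_comm _ _).trans (congrArg Idem.val h))

@[simp] theorem uval_toUnit [IsInverseSemigroup A] (a : A) {e : Idem A} (h : rIdem a = e) :
    uval (toUnit a h) = a := rfl

theorem rIdem_uval [IsInverseSemigroup A] {e : Idem A} (x : (unitalIdeal e)ˣ) :
    rIdem (uval x) = e := by
  have h1 : uval x * uval x⁻¹ = e := congrArg Subtype.val x.mul_inv
  have h2 : uval x⁻¹ = sinv (uval x) := by
    apply eq_sinv
    · rw [h1, idem_mul_uval]
    · rw [mul_comm (uval x⁻¹), h1, idem_mul_uval]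
  ext
  rw [coe_rIdem, ← h2, h1]

end UnitalIdeal

/-! ### Products of idempotents attached to tuples of group elements -/

section Tuple

variable {G E : Type*} [Group G] [CommMonoid E]

/-- `u(x₁) u(x₁ x₂) ⋯ u(x₁ ⋯ xₙ)`; it is `1` for `n = 0`. -/
def tupleIdem (u : G → E) {n : ℕ} (x : Fin n → G) : E :=
  ∏ i : Fin n, u (Fin.partialProd x i.succ)

theorem tupleIdem_succ (u : G → E) {n : ℕ} (x : Fin (n + 1) → G) :
    tupleIdem u x = u (x 0) * tupleIdem (fun y => u (x 0 * y)) (Fin.tail x) := by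
  unfold tupleIdem
  rw [Fin.prod_univ_succ]
  congr 1
  · rw [Fin.partialProd_succ', Fin.partialProd_zero, mul_one]
  · exact Finset.prod_congr rfl fun i _ => by rw [Fin.partialProd_succ']

theorem tupleIdem_mul_self (u : G → E) (hu : ∀ e : E, e * e = e) {n : ℕ} (x : Fin (n + 1) → G)
    (j : Fin (n + 1)) :
    tupleIdem u x * tupleIdem u (Fin.contractNth j (· * ·) x) = tupleIdem u x := by
  have key : ∀ (i : Fin (n + 1)), tupleIdem u x * u (Fin.partialProd x i.succ) =
      tupleIdem u x := by
    intro i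
    unfold tupleIdem
    rw [← Finset.mul_prod_erase _ _ (Finset.mem_univ i), mul_right_comm, hu]
  have key' : ∀ s : Finset (Fin n), tupleIdem u x *
      ∏ i ∈ s, u (Fin.partialProd (Fin.contractNth j (· * ·) x) i.succ) = tupleIdem u x := by
    intro s
    induction s using Finset.induction_on with
    | empty => simp
    | insert a s ha ih =>
      rw [Finset.prod_insert ha, ← mul_assoc]
      have : ∃ i : Fin (n + 1), Fin.partialProd (Fin.contractNth j (· * ·) x) a.succ =
          Fin.partialProd x i.succ := by
        rw [Fin.partialProd_contractNth]
        have hne : j.succ.succAbove a.succ ≠ 0 :=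
          Fin.succAbove_ne_zero (Fin.succ_ne_zero j) (Fin.succ_ne_zero a)
        obtain ⟨i, hi⟩ := Fin.exists_succ_eq.2 hne
        exact ⟨i, by simp [hi]⟩
      obtain ⟨i, hi⟩ := this
      rw [hi, key, ih]
  exact key' Finset.univ

end Tuple

/-! ### Unital partial actions and partial cohomology -/

/-- A unital partial action of a group `G` on a commutative monoid `A`, that is, the structure of a
partial `G`-module on `A`.  Here `idem x` is the idempotent `1_x`, the ideal `A_x` is
`unitalIdeal (idem x)`, and `θ x : A_{x⁻¹} → A_x` is an isomorphism of semigroups. -/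
structure PartialModule (G A : Type*) [Group G] [CommMonoid A] where
  idem : G → Idem A
  θ : ∀ x : G, unitalIdeal (idem x⁻¹) ≃* unitalIdeal (idem x)
  ideal_one : unitalIdeal (idem 1) = ⊤
  θ_one : ∀ a, (θ 1 a : A) = a
  image_inter : ∀ x y : G,
    (fun a => (θ x a : A)) '' {a | (a : A) ∈ unitalIdeal (idem y)} =
      (unitalIdeal (idem x) : Set A) ∩ unitalIdeal (idem (x * y))
  θ_comp : ∀ (x y : G) (a : unitalIdeal (idem y⁻¹))
    (h₁ : (θ y a : A) ∈ unitalIdeal (idem x⁻¹)) (h₂ : (a : A) ∈ unitalIdeal (idem (x * y)⁻¹)),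
    (θ x ⟨θ y a, h₁⟩ : A) = θ (x * y) ⟨a, h₂⟩

namespace PartialModule

variable {G A : Type*} [Group G] [CommMonoid A] (P : PartialModule G A)

/-- A partial `G`-module is inverse if `A` is inverse and `E(A)` is generated by the `1_x`. -/
def IsInverse : Prop :=
  IsInverseSemigroup A ∧
    ∀ e : A, e * e = e → e ∈ Subsemigroup.closure (Set.range fun x : G => (P.idem x : A))

/-- The map `a ↦ θ_x(1_{x⁻¹} a)`. -/
def act (x : G) : A →ₙ* A where
  toFun a := P.θ x ⟨P.idem x⁻¹ * a, by rw [mem_unitalIdeal, ← mul_assoc, (P.idem x⁻¹).2]⟩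
  map_mul' a b := by
    rw [← coe_mul_unitalIdeal, ← map_mul]
    congr 2
    exact Subtype.ext (map_mul (mulIdem (P.idem x⁻¹)) a b)

theorem act_idem (x y : G) : P.act x (P.idem y) = (P.idem x : A) * P.idem (x * y) := by
  have h1 : P.act x (P.idem y) ∈ (unitalIdeal (P.idem x) : Set A) ∩
      unitalIdeal (P.idem (x * y)) := by
    rw [← P.image_inter]
    refine ⟨⟨P.idem x⁻¹ * P.idem y, ?_⟩, ?_, rfl⟩
    · rw [mem_unitalIdeal, ← mul_assoc, (P.idem x⁻¹).2]
    · change _ * _ = _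
      rw [mul_left_comm, (P.idem y).2]
  have h2 : (P.idem x : A) * P.idem (x * y) ∈ (unitalIdeal (P.idem x) : Set A) ∩
      unitalIdeal (P.idem (x * y)) := by
    constructor
    · change _ * _ = _
      rw [← mul_assoc, (P.idem x).2]
    · change _ * _ = _
      rw [mul_left_comm, (P.idem (x * y)).2]
  have h3 := h2
  rw [← P.image_inter] at h3
  obtain ⟨a, ha, hc⟩ := h3
  have h4 : P.act x a = (P.idem x : A) * P.idem (x * y) := by
    rw [← hc]
    change (P.θ x _ : A) = P.θ x a
    congr 2
    exact Subtype.ext a.2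
  have h5 : P.act x (P.idem y) * ((P.idem x : A) * P.idem (x * y)) =
      (P.idem x : A) * P.idem (x * y) := by
    rw [← h4, ← map_mul, show (P.idem y : A) * a = a from ha]
  rw [← h5, mul_comm (P.act x _), mul_assoc, show _ * _ = _ from h1.2]
  exact h1.1.symm

theorem act_one (x : G) : P.act x 1 = P.idem x := by
  have : P.act x 1 = ((P.θ x 1 : unitalIdeal (P.idem x)) : A) := by
    change (P.θ x _ : A) = _
    congr 2
    exact Subtype.ext (mul_one _)
  rw [this, map_one]
  rfl

/-- The idempotent `1_{x₁} 1_{x₁x₂} ⋯ 1_{x₁⋯xₙ}`, which generates the ideal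
`A_{(x₁,…,xₙ)} = A_{x₁} A_{x₁x₂} ⋯ A_{x₁⋯xₙ}`. -/
def cochainIdem {n : ℕ} (x : Fin n → G) : Idem A := tupleIdem P.idem x

theorem act_prod (x : G) {ι : Type*} (s : Finset ι) (y : ι → G) :
    P.act x ((∏ i ∈ s, P.idem (y i) : Idem A) : A) =
      ((P.idem x * ∏ i ∈ s, P.idem (x * y i) : Idem A) : A) := by
  classical
  induction s using Finset.induction_on with
  | empty =>
    rw [Finset.prod_empty, Finset.prod_empty, mul_one, Idem.coe_one, act_one]
  | insert a s ha ih =>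
    rw [Finset.prod_insert ha, Finset.prod_insert ha, Idem.coe_mul, map_mul, ih, act_idem]
    rw [← Idem.coe_mul, ← Idem.coe_mul, mul_mul_mul_comm, Idem.mul_self]

theorem act_cochainIdem {n : ℕ} (x : Fin (n + 1) → G) :
    P.act (x 0) (P.cochainIdem (Fin.tail x)) = P.cochainIdem x := by
  unfold cochainIdem
  rw [tupleIdem_succ]
  exact P.act_prod _ _ _

theorem mulIdem_cochainIdem {n : ℕ} (x : Fin (n + 1) → G) (j : Fin (n + 1)) :
    mulIdem (P.cochainIdem x) (P.cochainIdem (Fin.contractNth j (· * ·) x)) =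
      P.cochainIdem x := by
  rw [mulIdem_apply, ← Idem.coe_mul]
  unfold cochainIdem
  rw [tupleIdem_mul_self _ Idem.mul_self]

/-- The group `Cⁿ(G, A)` of `n`-cochains: functions `f` on `Gⁿ` such that `f(x₁,…,xₙ)` is an
invertible element of the ideal `A_{(x₁,…,xₙ)}`, with pointwise multiplication.  For `n = 0` this
is the group of invertible elements of `A`. -/
abbrev Cochain (n : ℕ) : Type _ := (x : Fin n → G) → (unitalIdeal (P.cochainIdem x))ˣ

/-- The coboundary homomorphism: `(δⁿ f)(x₁,…,xₙ₊₁)` is the product of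
`θ_{x₁}(1_{x₁⁻¹} f(x₂,…,xₙ₊₁))`, of the `f(x₁,…,xᵢxᵢ₊₁,…,xₙ₊₁)^{(-1)^i}` for `1 ≤ i ≤ n`
and of `f(x₁,…,xₙ)^{(-1)^{n+1}}`.  The last factors are indexed by `j = 0,…,n`, with
`contractNth j x = (x₁,…,x_{j+1}x_{j+2},…)` for `j < n` and `contractNth n x = (x₁,…,xₙ)`;
they are moved into `A_{(x₁,…,xₙ₊₁)}` by multiplication by its identity element. -/
def coboundary (n : ℕ) : P.Cochain n →* P.Cochain (n + 1) where
  toFun f x :=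
    Units.map (idealMap (P.act (x 0)) (P.act_cochainIdem x)) (f (Fin.tail x)) *
      ∏ j : Fin (n + 1),
        Units.map (idealMap (mulIdem (P.cochainIdem x)) (P.mulIdem_cochainIdem x j))
          (f (Fin.contractNth j (· * ·) x)) ^ ((-1 : ℤ) ^ ((j : ℕ) + 1))
  map_one' := by
    funext x
    simp
  map_mul' f g := by
    funext x
    simp only [Pi.mul_apply, map_mul, mul_zpow, Finset.prod_mul_distrib]
    rw [mul_mul_mul_comm]

/-- In `A` itself the value of the coboundary is the product written in the definition of `δⁿ`,
the negative powers being inverses in the corresponding ideals. -/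
theorem uval_coboundary (n : ℕ) (f : P.Cochain n) (x : Fin (n + 1) → G) :
    uval (P.coboundary n f x) =
      P.act (x 0) (uval (f (Fin.tail x))) *
        ∏ j : Fin (n + 1),
          uval (f (Fin.contractNth j (· * ·) x) ^ ((-1 : ℤ) ^ ((j : ℕ) + 1))) := by
  have key : ∀ s : Finset (Fin (n + 1)),
      uval (Units.map (idealMap (P.act (x 0)) (P.act_cochainIdem x)) (f (Fin.tail x)) *
        ∏ j ∈ s,
          Units.map (idealMap (mulIdem (P.cochainIdem x)) (P.mulIdem_cochainIdem x j))
            (f (Fin.contractNth j (· * ·) x)) ^ ((-1 : ℤ) ^ ((j : ℕ) + 1))) =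
      P.act (x 0) (uval (f (Fin.tail x))) *
        ∏ j ∈ s, uval (f (Fin.contractNth j (· * ·) x) ^ ((-1 : ℤ) ^ ((j : ℕ) + 1))) := by
    intro s
    induction s using Finset.induction_on with
    | empty =>
      rw [Finset.prod_empty, Finset.prod_empty, mul_one, mul_one]
      rfl
    | insert a s ha ih =>
      rw [Finset.prod_insert ha, Finset.prod_insert ha, mul_left_comm, uval_mul, ih,
        ← map_zpow]
      change (P.cochainIdem x : A) * uval (f _ ^ ((-1 : ℤ) ^ ((a : ℕ) + 1))) * _ = _
      rw [mul_comm (P.cochainIdem x : A), mul_assoc, ← ih, idem_mul_uval, ih, mul_left_comm]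
  exact key Finset.univ

end PartialModule

/-! ### Cohomology of a sequence of homomorphisms -/

section SeqCohomology

variable {C : ℕ → Type*} [∀ n, AddCommGroup (C n)] (d : ∀ n, C n →+ C (n + 1))

/-- The coboundaries: `im dⁿ⁻¹`, and the zero subgroup for `n = 0`. -/
def seqCoboundaries : ∀ n, AddSubgroup (C n)
  | 0 => ⊥
  | n + 1 => (d n).range

/-- The `n`-th cohomology group `ker dⁿ / im dⁿ⁻¹` (which is `ker d⁰` for `n = 0`). -/
abbrev SeqCohomology (n : ℕ) : Type _ :=
  (d n).ker ⧸ (seqCoboundaries d n).addSubgroupOf (d n).ker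

end SeqCohomology

/-- The partial cohomology group `Hⁿ(G, A)`, written additively. -/
abbrev PartialModule.Cohomology {G A : Type*} [Group G] [CommMonoid A] (P : PartialModule G A)
    (n : ℕ) : Type _ :=
  SeqCohomology (C := fun n => Additive (P.Cochain n))
    (fun n => MonoidHom.toAdditive (P.coboundary n)) n

/-! ### Exel's monoid -/

/-- The defining relations of Exel's semigroup. -/
inductive ExelRel (G : Type u) [Group G] : FreeSemigroup G → FreeSemigroup G → Prop
  | left (x y : G) : ExelRel G
      (FreeSemigroup.of x⁻¹ * FreeSemigroup.of x * FreeSemigroup.of y)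
      (FreeSemigroup.of x⁻¹ * FreeSemigroup.of (x * y))
  | right (x y : G) : ExelRel G
      (FreeSemigroup.of x * FreeSemigroup.of y * FreeSemigroup.of y⁻¹)
      (FreeSemigroup.of (x * y) * FreeSemigroup.of y⁻¹)
  | one (x : G) : ExelRel G (FreeSemigroup.of x * FreeSemigroup.of 1) (FreeSemigroup.of x)

/-- Exel's monoid `S(G)`: the semigroup generated by symbols `[x]`, `x ∈ G`, subject to
`[x⁻¹][x][y] = [x⁻¹][xy]`, `[x][y][y⁻¹] = [xy][y⁻¹]` and `[x][1] = [x]`. -/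
def ExelMonoid (G : Type u) [Group G] : Type u := (conGen (ExelRel G)).Quotient

namespace ExelMonoid

variable {G : Type u} [Group G]

instance : Semigroup (ExelMonoid G) :=
  inferInstanceAs (Semigroup (conGen (ExelRel G)).Quotient)

/-- The quotient map from the free semigroup. -/
def mk (w : FreeSemigroup G) : ExelMonoid G := (w : (conGen (ExelRel G)).Quotient)

/-- The generator `[x]`. -/
def gen (x : G) : ExelMonoid G := mk (FreeSemigroup.of x)

theorem mk_mul (a b : FreeSemigroup G) : mk (a * b) = mk a * mk b := rfl

theorem mk_eq {a b : FreeSemigroup G} (h : ExelRel G a b) : mk a = mk b :=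
  (Con.eq _).2 (ConGen.Rel.of _ _ h)

theorem gen_left (x y : G) : gen x⁻¹ * gen x * gen y = gen x⁻¹ * gen (x * y) :=
  mk_eq (.left x y)

theorem gen_right (x y : G) : gen x * gen y * gen y⁻¹ = gen (x * y) * gen y⁻¹ :=
  mk_eq (.right x y)

theorem gen_mul_one (x : G) : gen x * gen 1 = gen x := mk_eq (.one x)

theorem gen_left' (x y : G) : gen x * gen x⁻¹ * gen y = gen x * gen (x⁻¹ * y) := by
  have := gen_left x⁻¹ y
  rwa [inv_inv] at this

theorem gen_inv_gen (x : G) : gen x * gen x⁻¹ * gen x = gen x := by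
  rw [gen_left', inv_mul_cancel, gen_mul_one]

theorem one_mul_gen (x : G) : gen 1 * gen x = gen x := by
  have := gen_right x x⁻¹
  rw [mul_inv_cancel, inv_inv, gen_inv_gen] at this
  exact this.symm

theorem ind {p : ExelMonoid G → Prop} (h₁ : ∀ x, p (gen x))
    (h₂ : ∀ x s, p s → p (gen x * s)) (s : ExelMonoid G) : p s := by
  obtain ⟨w, rfl⟩ : ∃ w, mk w = s := Quotient.exists_rep s
  induction w using FreeSemigroup.recOnMul with
  | ih1 x => exact h₁ x
  | ih2 x y _ ih => rw [mk_mul]; exact h₂ x _ ih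

instance : Monoid (ExelMonoid G) where
  one := gen 1
  one_mul s := by
    change gen 1 * s = s
    induction s using ind with
    | h₁ x => exact one_mul_gen x
    | h₂ x s _ => rw [← mul_assoc, one_mul_gen]
  mul_one s := by
    change s * gen 1 = s
    induction s using ind with
    | h₁ x => exact gen_mul_one x
    | h₂ x s ih => rw [mul_assoc, ih]

theorem gen_one : gen (1 : G) = 1 := rfl

/-- The idempotents `ε_x = [x][x⁻¹]`. -/
def eps (x : G) : ExelMonoid G := gen x * gen x⁻¹

theorem eps_mul_gen (x : G) : eps x * gen x = gen x := gen_inv_gen x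

theorem gen_mul_eps (x y : G) : gen x * eps y = eps (x * y) * gen x := by
  unfold eps
  rw [← mul_assoc, gen_right, gen_left']
  congr 2
  group

theorem gen_mul_gen (x y : G) : gen x * gen y = eps x * gen (x * y) := by
  unfold eps
  rw [gen_left', inv_mul_cancel_left]

theorem eps_comm (x y : G) : eps x * eps y = eps y * eps x := by
  nth_rewrite 1 [eps]
  rw [mul_assoc, gen_mul_eps, ← mul_assoc, gen_mul_eps, mul_inv_cancel_left, mul_assoc]
  rfl

theorem eps_idem (x : G) : eps x * eps x = eps x := by
  nth_rewrite 2 [eps]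
  rw [← mul_assoc, eps_mul_gen]
  rfl

/-- The submonoid generated by the `ε_x`. -/
def epsSub (G : Type u) [Group G] : Submonoid (ExelMonoid G) :=
  Submonoid.closure (Set.range eps)

theorem eps_mem (x : G) : eps x ∈ epsSub G := Submonoid.subset_closure ⟨x, rfl⟩

theorem eps_comm_mem (x : G) {p : ExelMonoid G} (hp : p ∈ epsSub G) : eps x * p = p * eps x := by
  induction hp using Submonoid.closure_induction with
  | mem p hp =>
    obtain ⟨y, rfl⟩ := hp
    exact eps_comm x y
  | one => rw [mul_one, one_mul]
  | mul p q _ _ hp hq => rw [← mul_assoc, hp, mul_assoc, hq, mul_assoc]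

theorem epsSub_comm {p q : ExelMonoid G} (hp : p ∈ epsSub G) (hq : q ∈ epsSub G) :
    p * q = q * p := by
  induction hp using Submonoid.closure_induction with
  | mem p hp =>
    obtain ⟨y, rfl⟩ := hp
    exact eps_comm_mem y hq
  | one => rw [mul_one, one_mul]
  | mul p r _ _ hp hr => rw [mul_assoc, hr, ← mul_assoc, hp, mul_assoc]

theorem epsSub_idem {p : ExelMonoid G} (hp : p ∈ epsSub G) : p * p = p := by
  induction hp using Submonoid.closure_induction with
  | mem p hp =>
    obtain ⟨y, rfl⟩ := hp
    exact eps_idem y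
  | one => rw [mul_one]
  | mul p q hp hq hp' hq' =>
    rw [mul_assoc, ← mul_assoc q, epsSub_comm hq hp, mul_assoc, hq', ← mul_assoc, hp']

theorem gen_mul_mem (x : G) {p : ExelMonoid G} (hp : p ∈ epsSub G) :
    ∃ q ∈ epsSub G, gen x * p = q * gen x := by
  induction hp using Submonoid.closure_induction with
  | mem p hp =>
    obtain ⟨y, rfl⟩ := hp
    exact ⟨_, eps_mem _, gen_mul_eps x y⟩
  | one => exact ⟨1, one_mem _, by rw [mul_one, one_mul]⟩
  | mul p q _ _ hp hq =>
    obtain ⟨p', hp', h₁⟩ := hp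
    obtain ⟨q', hq', h₂⟩ := hq
    exact ⟨p' * q', mul_mem hp' hq', by rw [← mul_assoc, h₁, mul_assoc, h₂, mul_assoc]⟩

theorem lift_eq {a b : FreeSemigroup G} (h : ConGen.Rel (ExelRel G) a b) :
    FreeSemigroup.lift (id : G → G) a = FreeSemigroup.lift (id : G → G) b := by
  induction h with
  | of a b h =>
    cases h <;> simp only [map_mul, FreeSemigroup.lift_of, id, mul_one, mul_assoc]
  | refl a => rfl
  | symm _ ih => exact ih.symm
  | trans _ _ ih₁ ih₂ => exact ih₁.trans ih₂
  | mul _ _ ih₁ ih₂ => rw [map_mul, map_mul, ih₁, ih₂]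

/-- The natural homomorphism `S(G) → G`, `[x] ↦ x`. -/
def toGroup : ExelMonoid G →* G where
  toFun := Quotient.lift (FreeSemigroup.lift (id : G → G)) (fun _ _ h => lift_eq h)
  map_one' := rfl
  map_mul' a b := by
    obtain ⟨a, rfl⟩ := Quotient.exists_rep a
    obtain ⟨b, rfl⟩ := Quotient.exists_rep b
    exact map_mul (FreeSemigroup.lift (id : G → G)) a b

@[simp] theorem toGroup_gen (x : G) : toGroup (gen x) = x := rfl

theorem exists_normal (s : ExelMonoid G) : ∃ p ∈ epsSub G, s = p * gen (toGroup s) := by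
  induction s using ind with
  | h₁ x => exact ⟨1, one_mem _, by rw [one_mul, toGroup_gen]⟩
  | h₂ x s ih =>
    obtain ⟨p, hp, h⟩ := ih
    obtain ⟨q, hq, hq'⟩ := gen_mul_mem x hp
    refine ⟨q * eps x, mul_mem hq (eps_mem x), ?_⟩
    rw [map_mul, toGroup_gen, mul_assoc, ← gen_mul_gen, ← mul_assoc, ← hq', mul_assoc, ← h]

theorem mem_epsSub_of_idem {s : ExelMonoid G} (h : s * s = s) : s ∈ epsSub G := by
  obtain ⟨p, hp, hs⟩ := exists_normal s
  have h1 : toGroup s = 1 := by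
    have := congrArg toGroup h
    rwa [map_mul, mul_eq_right] at this
  rw [h1, gen_one, mul_one] at hs
  rwa [hs]

instance : IsInverseSemigroup (ExelMonoid G) := by
  have : IdemComm (ExelMonoid G) :=
    ⟨fun e f he hf => epsSub_comm (mem_epsSub_of_idem he) (mem_epsSub_of_idem hf)⟩
  refine IsInverseSemigroup.of_regular fun s => ?_
  obtain ⟨p, hp, hs⟩ := exists_normal s
  generalize toGroup s = y at hs
  subst hs
  have hpp := epsSub_idem hp
  have hc := eps_comm_mem y hp
  refine ⟨gen y⁻¹ * p, ?_, ?_⟩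
  · calc p * gen y * (gen y⁻¹ * p) * (p * gen y)
        = p * eps y * (p * p) * gen y := by simp only [eps, mul_assoc]
      _ = p * (eps y * p) * gen y := by rw [hpp]; simp only [mul_assoc]
      _ = (p * p) * (eps y * gen y) := by rw [hc]; simp only [mul_assoc]
      _ = p * gen y := by rw [hpp, eps_mul_gen]
  · calc gen y⁻¹ * p * (p * gen y) * (gen y⁻¹ * p)
        = gen y⁻¹ * (p * p) * eps y * p := by simp only [eps, mul_assoc]
      _ = gen y⁻¹ * (p * eps y) * p := by rw [hpp]; simp only [mul_assoc]
      _ = gen y⁻¹ * eps y * (p * p) := by rw [← hc]; simp only [mul_assoc]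
      _ = (gen y⁻¹ * gen y * gen y⁻¹) * p := by rw [hpp]; simp only [eps, mul_assoc]
      _ = gen y⁻¹ * p := by
        have := gen_inv_gen y⁻¹
        rw [inv_inv] at this
        rw [this]

end ExelMonoid

/-! ### Modules over an inverse monoid -/

/-- The structure of a (unital) module over the inverse monoid `S` on a commutative monoid `A`:
homomorphisms `λ : S → End A` (endomorphisms of the semigroup `A`) and `α : E(S) → E(A)` of monoids
with `λ_e(a) = α(e) a` and `λ_s(α(e)) = α(s e s⁻¹)`. -/
structure SModule (S A : Type*) [Monoid S] [IsInverseSemigroup S] [CommMonoid A] where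
  lam : S → A →ₙ* A
  lam_one : ∀ a, lam 1 a = a
  lam_mul : ∀ s t a, lam (s * t) a = lam s (lam t a)
  alpha : Idem S →* Idem A
  lam_idem : ∀ (e : Idem S) (a : A), lam e a = alpha e * a
  lam_alpha : ∀ (s : S) (e : Idem S), lam s (alpha e) = alpha (conj s e)

namespace SModule

variable {S A : Type*} [Monoid S] [IsInverseSemigroup S] [CommMonoid A] (M : SModule S A)

/-- The set `L(A, S)` of symbols `a δ_s` with `a ∈ α(s s⁻¹) A`. -/
@[ext] structure Sym where
  a : A
  s : S
  mem : a ∈ unitalIdeal (M.alpha (rIdem s))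

/-- The multiplication `a δ_s · b δ_t = a λ_s(b) δ_{st}`. -/
instance : Mul M.Sym where
  mul p q := ⟨p.a * M.lam p.s q.a, p.s * q.s, by
    have hq := q.mem
    have hp := p.mem
    rw [mem_unitalIdeal] at *
    have h : rIdem (p.s * q.s) = conj p.s (rIdem q.s) := by
      ext
      simp only [coe_rIdem, coe_conj, sinv_mul, mul_assoc]
    rw [h, ← M.lam_alpha, mul_left_comm, ← map_mul, hq]⟩

@[simp] theorem Sym.mul_a (p q : M.Sym) : (p * q).a = p.a * M.lam p.s q.a := rfl

@[simp] theorem Sym.mul_s (p q : M.Sym) : (p * q).s = p.s * q.s := rfl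

/-- The relation `{(a δ_s, a δ_t) | s ≤ t}`, where `s ≤ t` means `s = e t` for an idempotent `e`. -/
def symRel (p q : M.Sym) : Prop := p.a = q.a ∧ ∃ e : Idem S, p.s = e * q.s

/-- The semidirect product `A ⋊ S`: the quotient of `L(A, S)` by the congruence `ρ` generated by
`symRel`. -/
def Semidirect : Type _ := (conGen M.symRel).Quotient

instance : Mul M.Semidirect := inferInstanceAs (Mul (conGen M.symRel).Quotient)

/-- The map `S → A ⋊ S` sending `s` to the class of `α(s s⁻¹) δ_s`. -/
def toSemidirect (s : S) : M.Semidirect :=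
  ((⟨M.alpha (rIdem s), s, (M.alpha (rIdem s)).2⟩ : M.Sym) : (conGen M.symRel).Quotient)

end SModule

/-! ### The category of strict inverse modules -/

/-- A strict inverse `S`-module: the monoid `A` is inverse and `α` is an isomorphism.  Modules are
written multiplicatively. -/
structure StrictMod (S : Type u) [Monoid S] [IsInverseSemigroup S] where
  carrier : Type u
  [commMonoid : CommMonoid carrier]
  [isInverse : IsInverseSemigroup carrier]
  str : SModule S carrier
  strict : Function.Bijective str.alpha

namespace StrictMod

variable {S : Type u} [Monoid S] [IsInverseSemigroup S]

instance : CoeSort (StrictMod S) (Type u) := ⟨carrier⟩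

instance (M : StrictMod S) : CommMonoid M := M.commMonoid

instance (M : StrictMod S) : IsInverseSemigroup M := M.isInverse

/-- The endomorphisms `λ_s`. -/
abbrev lam (M : StrictMod S) (s : S) : M →ₙ* M := M.str.lam s

/-- The homomorphism `α`. -/
abbrev alpha (M : StrictMod S) : Idem S →* Idem M := M.str.alpha

/-- The index `e` of the component `A_e = {a | a a⁻¹ = α(e)}` that contains `a`. -/
def deg (M : StrictMod S) (a : M) : Idem S :=
  (Equiv.ofBijective M.alpha M.strict).symm (rIdem a)

theorem alpha_deg (M : StrictMod S) (a : M) : M.alpha (M.deg a) = rIdem a :=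
  (Equiv.ofBijective M.alpha M.strict).apply_symm_apply _

theorem deg_eq_iff (M : StrictMod S) {a : M} {e : Idem S} :
    M.deg a = e ↔ rIdem a = M.alpha e := by
  rw [← M.alpha_deg]
  exact (M.strict.1.eq_iff).symm

theorem alpha_deg_mul (M : StrictMod S) (a : M) : (M.alpha (M.deg a) : M) * a = a := by
  rw [alpha_deg, rIdem_mul_self]

theorem deg_mul (M : StrictMod S) (a b : M) : M.deg (a * b) = M.deg a * M.deg b := by
  rw [deg_eq_iff, map_mul, alpha_deg, alpha_deg]
  ext
  simp only [coe_rIdem, Idem.coe_mul, sinv_mul]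
  rw [mul_comm (sinv b), mul_mul_mul_comm]

theorem deg_lam (M : StrictMod S) (s : S) (a : M) : M.deg (M.lam s a) = conj s (M.deg a) := by
  rw [deg_eq_iff]
  ext
  rw [coe_rIdem, ← map_sinv, ← map_mul, ← coe_rIdem, ← alpha_deg, M.str.lam_alpha]

theorem deg_sinv (M : StrictMod S) (a : M) : M.deg (sinv a) = M.deg a := by
  rw [deg_eq_iff, alpha_deg]
  ext
  rw [coe_rIdem, coe_rIdem, ← eq_sinv (sinv_mul_sinv a) (mul_sinv_mul a), mul_comm]

theorem deg_alpha (M : StrictMod S) (e : Idem S) : M.deg (M.alpha e) = e := by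
  rw [deg_eq_iff, rIdem_idem]

/-- Morphisms of `S`-modules. -/
@[ext] structure Hom (M N : StrictMod S) where
  toMulHom : M →ₙ* N
  map_alpha : ∀ e : Idem S, toMulHom (M.alpha e) = N.alpha e
  map_lam : ∀ (s : S) (a : M), toMulHom (M.lam s a) = N.lam s (toMulHom a)

instance : Category (StrictMod S) where
  Hom := Hom
  id M := ⟨MulHom.id M, fun _ => rfl, fun _ _ => rfl⟩
  comp f g := ⟨g.toMulHom.comp f.toMulHom,
    fun e => by rw [MulHom.comp_apply, f.map_alpha, g.map_alpha],
    fun s a => by rw [MulHom.comp_apply, f.map_lam, g.map_lam]; rfl⟩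

/-- The map underlying a morphism. -/
def Hom.app {M N : StrictMod S} (f : M ⟶ N) : M →ₙ* N := Hom.toMulHom f

theorem Hom.app_alpha {M N : StrictMod S} (f : M ⟶ N) (e : Idem S) :
    Hom.app f (M.alpha e) = N.alpha e := Hom.map_alpha f e

theorem Hom.app_lam {M N : StrictMod S} (f : M ⟶ N) (s : S) (a : M) :
    Hom.app f (M.lam s a) = N.lam s (Hom.app f a) := Hom.map_lam f s a

@[simp] theorem Hom.app_comp {M N K : StrictMod S} (f : M ⟶ N) (g : N ⟶ K) (a : M) :
    Hom.app (f ≫ g) a = Hom.app g (Hom.app f a) := rfl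

@[simp] theorem Hom.app_id {M : StrictMod S} (a : M) : Hom.app (𝟙 M) a = a := rfl

theorem hom_ext {M N : StrictMod S} {f g : M ⟶ N} (h : ∀ a, Hom.app f a = Hom.app g a) :
    f = g := Hom.ext (MulHom.ext h)

theorem deg_app {M N : StrictMod S} (f : M ⟶ N) (a : M) : N.deg (Hom.app f a) = M.deg a := by
  rw [deg_eq_iff]
  ext
  rw [coe_rIdem, ← map_sinv, ← map_mul, ← coe_rIdem, ← alpha_deg, Hom.app_alpha]

/-- The sum of two morphisms is their pointwise product. -/
instance (M N : StrictMod S) : Add (M ⟶ N) where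
  add f g := ⟨⟨fun a => Hom.app f a * Hom.app g a, fun a b => by
      rw [map_mul, map_mul, mul_mul_mul_comm]⟩,
    fun e => by
      change Hom.app f _ * Hom.app g _ = _
      rw [Hom.app_alpha, Hom.app_alpha, (N.alpha e).2],
    fun s a => by
      change Hom.app f _ * Hom.app g _ = N.lam s (_ * _)
      rw [Hom.app_lam, Hom.app_lam, map_mul]⟩

/-- The zero morphism sends the component `M_e` to the identity element `α(e)` of `N_e`. -/
instance (M N : StrictMod S) : Zero (M ⟶ N) where
  zero := ⟨⟨fun a => N.alpha (M.deg a), fun a b => by rw [deg_mul, map_mul]; rfl⟩,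
    fun e => by
      change ((N.alpha (M.deg (M.alpha e))) : N) = _
      rw [deg_alpha],
    fun s a => by
      change ((N.alpha (M.deg (M.lam s a))) : N) = N.lam s (N.alpha _)
      rw [deg_lam, N.str.lam_alpha]⟩

instance (M N : StrictMod S) : Neg (M ⟶ N) where
  neg f := ⟨⟨fun a => sinv (Hom.app f a), fun a b => by
      rw [map_mul, sinv_mul, mul_comm]⟩,
    fun e => by
      change sinv (Hom.app f _) = _
      rw [Hom.app_alpha, sinv_idem (N.alpha e).2],
    fun s a => by
      change sinv (Hom.app f _) = N.lam s (sinv _)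
      rw [Hom.app_lam, map_sinv]⟩

instance (M N : StrictMod S) : AddCommGroup (M ⟶ N) where
  nsmul := nsmulRec
  zsmul := zsmulRec
  add_assoc f g h := hom_ext fun a => mul_assoc _ _ _
  add_comm f g := hom_ext fun a => mul_comm _ _
  zero_add f := hom_ext fun a => by
    change (N.alpha (M.deg a) : N) * Hom.app f a = _
    rw [← Hom.app_alpha f, ← map_mul, alpha_deg_mul]
  add_zero f := hom_ext fun a => by
    change Hom.app f a * (N.alpha (M.deg a) : N) = _
    rw [← Hom.app_alpha f, ← map_mul, mul_comm, alpha_deg_mul]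
  neg_add_cancel f := hom_ext fun a => by
    change sinv (Hom.app f a) * Hom.app f a = N.alpha (M.deg a)
    rw [← deg_app f, alpha_deg, mul_comm, coe_rIdem]

@[simp] theorem Hom.app_add {M N : StrictMod S} (f g : M ⟶ N) (a : M) :
    Hom.app (f + g) a = Hom.app f a * Hom.app g a := rfl

@[simp] theorem Hom.app_zero {M N : StrictMod S} (a : M) :
    Hom.app (0 : M ⟶ N) a = N.alpha (M.deg a) := rfl

instance : Preadditive (StrictMod S) where
  add_comp _ _ _ f f' g := hom_ext fun a => by simp
  comp_add _ _ _ f g g' := hom_ext fun a => by simp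

/-- The kernel of a morphism: `(ker φ)_e = φ⁻¹(α(e))`. -/
def Hom.kernel {M N : StrictMod S} (f : M ⟶ N) : Set M :=
  {a | ∃ e : Idem S, Hom.app f a = N.alpha e}

/-- The image of a morphism. -/
def Hom.image {M N : StrictMod S} (f : M ⟶ N) : Set N := Set.range (Hom.app f)

end StrictMod

/-! ### Strict inverse modules given by their components -/

/-- A family of (additive) abelian groups `X_e`, `e ∈ E(S)`, with homomorphisms
`X_e → X_{s e s⁻¹}` for `s ∈ S`. -/
structure Components (S : Type u) [Monoid S] [IsInverseSemigroup S] where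
  X : Idem S → Type u
  [grp : ∀ e, AddCommGroup (X e)]
  act : ∀ (s : S) {e f : Idem S}, conj s e = f → X e →+ X f
  act_idem : ∀ {e f : Idem S} (h : conj (f : S) e = e) (a : X e), act f h a = a
  act_mul : ∀ (s t : S) {e f g : Idem S} (h₁ : conj t e = f) (h₂ : conj s f = g)
    (h₃ : conj (s * t) e = g) (a : X e), act (s * t) h₃ a = act s h₂ (act t h₁ a)

namespace Components

variable {S : Type u} [Monoid S] [IsInverseSemigroup S] (L : Components S)

instance (e : Idem S) : AddCommGroup (L.X e) := L.grp e

theorem act_act {s t : S} {e f g : Idem S} (h₁ : conj t e = f) (h₂ : conj s f = g) (a : L.X e) :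
    L.act s h₂ (L.act t h₁ a) = L.act (s * t) (by rw [conj_mul, h₁, h₂]) a :=
  (L.act_mul s t h₁ h₂ _ a).symm

theorem act_congr {s t : S} (hst : s = t) {e f : Idem S} (h : conj s e = f) (a : L.X e) :
    L.act s h a = L.act t (hst ▸ h) a := by subst hst; rfl

/-- The disjoint union of the components. -/
@[ext] structure Total where
  idx : Idem S
  el : L.X idx

variable {L}

theorem Total.mk_eq {e f : Idem S} {a : L.X e} {b : L.X f} (h : conj (1 : S) e = f)
    (hab : L.act 1 h a = b) : (⟨e, a⟩ : L.Total) = ⟨f, b⟩ := by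
  have : e = f := by rw [← h, conj_one]
  subst this
  congr 1
  rw [← hab]
  exact (L.act_idem (f := (1 : Idem S)) h a).symm

theorem act_self {f e : Idem S} (h : conj (f : S) e = e) (a : L.X e) : L.act f h a = a :=
  L.act_idem h a

theorem conj_idem' (f e : Idem S) : conj (f : S) e = e * f := by rw [conj_idem, mul_comm]

/-- The sum of elements of `X_e` and `X_f` is taken after moving both into `X_{ef}`. -/
instance : Mul L.Total where
  mul p q := ⟨p.idx * q.idx,
    L.act (q.idx : S) (conj_idem' _ _) p.el + L.act (p.idx : S) (conj_idem _ _) q.el⟩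

instance : One L.Total where
  one := ⟨1, 0⟩

theorem Total.mul_def (e f : Idem S) (a : L.X e) (b : L.X f) :
    (⟨e, a⟩ : L.Total) * ⟨f, b⟩ = ⟨e * f,
      L.act (f : S) (conj_idem' _ _) a + L.act (e : S) (conj_idem _ _) b⟩ := rfl

theorem Total.one_def : (1 : L.Total) = ⟨1, 0⟩ := rfl

instance : CommMonoid L.Total where
  mul_assoc := by
    rintro ⟨e, a⟩ ⟨f, b⟩ ⟨g, c⟩
    rw [Total.mul_def, Total.mul_def, Total.mul_def, Total.mul_def]
    refine Total.mk_eq (by rw [conj_one]; exact mul_assoc e f g) ?_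
    simp only [map_add, act_act, add_assoc]
    refine congrArg₂ (· + ·) (act_congr _ ?_ _ _) (congrArg₂ (· + ·) (act_congr _ ?_ _ _)
      (act_congr _ ?_ _ _))
    · rw [one_mul, ← Idem.coe_mul, mul_comm g f]
    · rw [one_mul, ← Idem.coe_mul, ← Idem.coe_mul, mul_comm g e]
    · rw [one_mul]; rfl
  one_mul := by
    rintro ⟨e, a⟩
    rw [Total.one_def, Total.mul_def]
    refine Total.mk_eq (by rw [conj_one]; exact one_mul e) ?_
    simp only [map_zero, zero_add, act_act]
    rw [act_congr _ (one_mul _)]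
    exact act_self (f := (1 : Idem S)) _ a
  mul_one := by
    rintro ⟨e, a⟩
    rw [Total.one_def, Total.mul_def]
    refine Total.mk_eq (by rw [conj_one]; exact mul_one e) ?_
    simp only [map_zero, add_zero, act_act]
    rw [act_congr _ (one_mul _)]
    exact act_self (f := (1 : Idem S)) _ a
  mul_comm := by
    rintro ⟨e, a⟩ ⟨f, b⟩
    rw [Total.mul_def, Total.mul_def]
    refine Total.mk_eq (by rw [conj_one]; exact mul_comm e f) ?_
    simp only [map_add, act_act]
    rw [add_comm]
    exact congrArg₂ (· + ·) (act_congr _ (one_mul _) _ _) (act_congr _ (one_mul _) _ _)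

theorem Total.mk_mul_mk (e : Idem S) (a b : L.X e) :
    (⟨e, a⟩ : L.Total) * ⟨e, b⟩ = ⟨e, a + b⟩ := by
  refine Total.mk_eq (by rw [conj_one]; exact e.mul_self) ?_
  have h : conj (e : S) e = e := by rw [conj_idem, e.mul_self]
  simp only [map_add, act_act]
  refine congrArg₂ (· + ·) ?_ ?_
  · rw [act_congr _ (one_mul _)]; exact act_self h a
  · rw [act_congr _ (one_mul _)]; exact act_self h b

theorem Total.regular (p : L.Total) : p * ⟨p.idx, -p.el⟩ * p = p ∧
    (⟨p.idx, -p.el⟩ : L.Total) * p * ⟨p.idx, -p.el⟩ = ⟨p.idx, -p.el⟩ := by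
  obtain ⟨e, a⟩ := p
  simp only [Total.mk_mul_mk]
  constructor <;> simp

instance : IsInverseSemigroup L.Total :=
  IsInverseSemigroup.of_regular fun p => ⟨_, p.regular⟩

theorem Total.sinv_def (p : L.Total) : sinv p = ⟨p.idx, -p.el⟩ :=
  (eq_sinv p.regular.1 p.regular.2).symm

variable (L) in
/-- The action of `s ∈ S` on the disjoint union. -/
def totalLam (s : S) : L.Total →ₙ* L.Total where
  toFun p := ⟨conj s p.idx, L.act s rfl p.el⟩
  map_mul' := by
    rintro ⟨e, a⟩ ⟨f, b⟩
    rw [Total.mul_def, Total.mul_def]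
    refine Total.mk_eq (by rw [conj_one]; exact conj_mul_idem s e f) ?_
    simp only [map_add, act_act]
    have key : ∀ e : Idem S, s * (e : S) = (conj s e : S) * s := fun e => by
      rw [coe_conj, mul_assoc, mul_assoc, ← IdemComm.comm _ _ (sinv_mul_idem s) e.2,
        ← mul_assoc, ← mul_assoc, mul_sinv_mul]
    refine congrArg₂ (· + ·) (act_congr _ ?_ _ _) (act_congr _ ?_ _ _) <;>
    · rw [one_mul, key]

theorem totalLam_mk (s : S) (e : Idem S) (a : L.X e) :
    L.totalLam s ⟨e, a⟩ = ⟨conj s e, L.act s rfl a⟩ := rfl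

variable (L) in
/-- The identity elements of the components. -/
def totalAlpha : Idem S →* Idem L.Total where
  toFun e := ⟨⟨e, 0⟩, by rw [Total.mk_mul_mk, add_zero]⟩
  map_one' := rfl
  map_mul' e f := by
    ext1
    change (⟨e * f, 0⟩ : L.Total) = ⟨e, 0⟩ * ⟨f, 0⟩
    rw [Total.mul_def (L := L) e f, map_zero, map_zero, add_zero]

theorem coe_totalAlpha (e : Idem S) : (L.totalAlpha e : L.Total) = ⟨e, 0⟩ := rfl

variable (L) in
/-- The strict inverse module with components `X_e`. -/
def toStrictMod : StrictMod S where
  carrier := L.Total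
  str :=
    { lam := L.totalLam
      lam_one := by
        rintro ⟨e, a⟩
        rw [totalLam_mk]
        refine Total.mk_eq (by rw [conj_one]; exact conj_one e) ?_
        rw [act_act, act_congr _ (one_mul _)]
        exact act_self (f := (1 : Idem S)) _ a
      lam_mul := by
        rintro s t ⟨e, a⟩
        rw [totalLam_mk, totalLam_mk, totalLam_mk]
        refine Total.mk_eq (by rw [conj_one]; exact conj_mul s t e) ?_
        rw [act_act, act_act]
        exact act_congr _ (one_mul _) _ _
      alpha := L.totalAlpha
      lam_idem := by
        rintro f ⟨e, a⟩
        rw [totalLam_mk, coe_totalAlpha, Total.mul_def]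
        refine Total.mk_eq (by rw [conj_one]; exact conj_idem f e) ?_
        simp only [map_zero, zero_add, act_act]
        exact act_congr _ (one_mul _) _ _
      lam_alpha := fun s e => by
        rw [coe_totalAlpha, coe_totalAlpha, totalLam_mk, map_zero] }
  strict := by
    constructor
    · intro e f h
      exact congrArg (fun i : Idem L.Total => i.val.idx) h
    · rintro ⟨⟨e, a⟩, h⟩
      refine ⟨e, ?_⟩
      ext1
      change (⟨e, 0⟩ : L.Total) = ⟨e, a⟩
      rw [Total.mk_mul_mk, Total.mk.injEq] at h
      have h0 : a + a = a := eq_of_heq h.2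
      rw [add_eq_right] at h0
      rw [h0]

variable (L) in
/-- The element of the module given by an element of a component. -/
def toStrictModEl {e : Idem S} (a : L.X e) : L.toStrictMod := (⟨e, a⟩ : L.Total)

theorem deg_toStrictModEl {e : Idem S} (a : L.X e) :
    L.toStrictMod.deg (L.toStrictModEl a) = e := by
  rw [StrictMod.deg_eq_iff]
  ext1
  change (⟨e, a⟩ : L.Total) * sinv (⟨e, a⟩ : L.Total) = ⟨e, 0⟩
  rw [Total.sinv_def, Total.mk_mul_mk, add_neg_cancel]

/-- A compatible family of homomorphisms from the `X_e` to the components of `M` gives a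
morphism of modules. -/
def homMk {M : StrictMod S} (η : ∀ e, L.X e →+ Additive (unitalIdeal (M.alpha e))ˣ)
    (hη : ∀ (s : S) (e : Idem S) (a : L.X e),
      uval (Additive.toMul (η (conj s e) (L.act s rfl a))) =
        M.lam s (uval (Additive.toMul (η e a)))) : L.toStrictMod ⟶ M where
  toMulHom :=
    { toFun := fun p : L.Total => uval (Additive.toMul (η p.idx p.el))
      map_mul' := by
        have hη' : ∀ (s : S) {e f : Idem S} (h : conj s e = f) (a : L.X e),
            uval (Additive.toMul (η f (L.act s h a))) =
              M.lam s (uval (Additive.toMul (η e a))) := by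
          intro s e f h a
          subst h
          exact hη s e a
        rintro ⟨e, a⟩ ⟨f, b⟩
        change uval (Additive.toMul (η (e * f) (_ + _))) = _
        rw [map_add, toMul_add, uval_mul, hη', hη', M.str.lam_idem, M.str.lam_idem,
          mul_mul_mul_comm, mul_comm (M.str.alpha f : M), mul_mul_mul_comm]
        exact congrArg₂ (· * ·) (idem_mul_uval _) (idem_mul_uval _) }
  map_alpha e := by
    change uval (Additive.toMul (η e 0)) = _
    rw [map_zero]
    rfl
  map_lam := fun s p => hη s p.idx p.el

end Components

/-! ### The category of strict inverse modules is abelian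

This is shown by identifying it with a category of functors to abelian groups. -/

/-- The category with objects the idempotents of `S`, in which the morphisms `e ⟶ f` are the
elements `s` with `s e = s` and `s s⁻¹ = f`. -/
structure LCat (S : Type u) [Monoid S] where
  idem : Idem S

namespace LCat

variable {S : Type u} [Monoid S] [IsInverseSemigroup S]

/-- Morphisms of `LCat S`. -/
@[ext] structure Hom (e f : LCat S) where
  s : S
  mul_source : s * e.idem = s
  target : rIdem s = f.idem

instance : Category (LCat S) where
  Hom := Hom
  id e := ⟨e.idem, e.idem.2, rIdem_idem _⟩
  comp {e f g} p q := ⟨q.s * p.s, by rw [mul_assoc, p.mul_source], by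
    have : rIdem (q.s * p.s) = conj q.s (rIdem p.s) := by
      ext
      simp only [coe_rIdem, coe_conj, sinv_mul, mul_assoc]
    rw [this, p.target, conj_eq_rIdem q.mul_source, q.target]⟩
  id_comp p := Hom.ext p.mul_source
  comp_id {e f} p := Hom.ext (by
    change (f.idem : S) * p.s = p.s
    rw [← p.target, rIdem_mul_self])
  assoc p q r := Hom.ext (mul_assoc _ _ _).symm

/-- The morphism `e ⟶ s e s⁻¹` given by `s e`. -/
def homMk (s : S) {e f : Idem S} (h : conj s e = f) : LCat.mk e ⟶ LCat.mk f :=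
  (⟨s * e, by rw [mul_assoc, e.2], by
    rw [← conj_eq_rIdem (show s * e.val * e.val = s * e.val by rw [mul_assoc, e.2]), conj_mul,
      conj_idem, Idem.mul_self]
    exact h⟩ : Hom _ _)

/-- The element underlying a morphism. -/
def Hom.el {e f : LCat S} (p : e ⟶ f) : S := Hom.s p

theorem Hom.el_mul {e f : LCat S} (p : e ⟶ f) : Hom.el p * e.idem = Hom.el p :=
  Hom.mul_source p

theorem Hom.conj_el {e f : LCat S} (p : e ⟶ f) : conj (Hom.el p) e.idem = f.idem :=
  (conj_eq_rIdem (Hom.el_mul p)).trans (Hom.target p)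

theorem hom_ext {e f : LCat S} {p q : e ⟶ f} (h : Hom.el p = Hom.el q) : p = q := Hom.ext h

@[simp] theorem el_comp {e f g : LCat S} (p : e ⟶ f) (q : f ⟶ g) :
    Hom.el (p ≫ q) = Hom.el q * Hom.el p := rfl

@[simp] theorem el_id (e : LCat S) : Hom.el (𝟙 e) = e.idem := rfl

@[simp] theorem el_homMk (s : S) {e f : Idem S} (h : conj s e = f) :
    Hom.el (homMk s h) = s * e := rfl

end LCat

namespace StrictMod

variable {S : Type u} [Monoid S] [IsInverseSemigroup S]

theorem lam_alpha_eq (M : StrictMod S) (s : S) {e f : Idem S} (h : conj s e = f) :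
    M.lam s (M.alpha e) = M.alpha f := by rw [M.str.lam_alpha, h]

/-- `λ_s` as a homomorphism between components. -/
def compMap (M : StrictMod S) (s : S) {e f : Idem S} (h : conj s e = f) :
    (unitalIdeal (M.alpha e))ˣ →* (unitalIdeal (M.alpha f))ˣ :=
  Units.map (idealMap (M.lam s) (M.lam_alpha_eq s h))

@[simp] theorem uval_compMap (M : StrictMod S) (s : S) {e f : Idem S} (h : conj s e = f)
    (x : (unitalIdeal (M.alpha e))ˣ) : uval (M.compMap s h x) = M.lam s (uval x) := rfl

theorem compMap_idem (M : StrictMod S) {e : Idem S} (h : conj (e : S) e = e) :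
    M.compMap (e : S) h = MonoidHom.id _ := by
  ext1 x
  apply uval_injective
  rw [uval_compMap, M.str.lam_idem, idem_mul_uval]
  rfl

/-- The functor of components of a module. -/
def toFunctorObj (M : StrictMod S) : LCat S ⥤ AddCommGrpCat.{u} where
  obj e := AddCommGrpCat.of (Additive (unitalIdeal (M.alpha e.idem))ˣ)
  map p := AddCommGrpCat.ofHom (MonoidHom.toAdditive (M.compMap (LCat.Hom.el p)
    (LCat.Hom.conj_el p)))
  map_id e := congrArg (fun φ => AddCommGrpCat.ofHom (MonoidHom.toAdditive φ))
    (M.compMap_idem (LCat.Hom.conj_el (𝟙 e)))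
  map_comp p q := by
    ext x
    apply Additive.toMul.injective
    apply uval_injective
    exact M.str.lam_mul (LCat.Hom.el q) (LCat.Hom.el p) (uval (Additive.toMul x))

/-- A morphism as a homomorphism between components. -/
def homComp {M N : StrictMod S} (f : M ⟶ N) (e : Idem S) :
    (unitalIdeal (M.alpha e))ˣ →* (unitalIdeal (N.alpha e))ˣ :=
  Units.map (idealMap (Hom.app f) (Hom.app_alpha f e))

@[simp] theorem uval_homComp {M N : StrictMod S} (f : M ⟶ N) (e : Idem S)
    (x : (unitalIdeal (M.alpha e))ˣ) : uval (homComp f e x) = Hom.app f (uval x) := rfl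

/-- The functor sending a module to its components. -/
def toFunctor (S : Type u) [Monoid S] [IsInverseSemigroup S] :
    StrictMod S ⥤ (LCat S ⥤ AddCommGrpCat.{u}) where
  obj := toFunctorObj
  map f :=
    { app := fun e => AddCommGrpCat.ofHom (MonoidHom.toAdditive (homComp f e.idem))
      naturality := fun e e' p => by
        ext x
        apply Additive.toMul.injective
        apply uval_injective
        exact Hom.app_lam f _ _ }
  map_id M := rfl
  map_comp f g := rfl

theorem rIdem_eq (M : StrictMod S) (a : M) : rIdem a = M.alpha (M.deg a) := (M.alpha_deg a).symm

instance : (toFunctor S).Faithful where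
  map_injective {M N f g} h := hom_ext fun a => by
    have h1 := congrArg (fun η => η.app (LCat.mk (M.deg a))) h
    have h2 := congrArg (fun η => uval (Additive.toMul
      (η.hom (Additive.ofMul (toUnit a (M.rIdem_eq a)))))) h1
    exact h2

/-- The map underlying a natural transformation of functors of components. -/
def natApp {M N : StrictMod S} (η : (toFunctor S).obj M ⟶ (toFunctor S).obj N) {e : Idem S}
    (x : (unitalIdeal (M.alpha e))ˣ) : (unitalIdeal (N.alpha e))ˣ :=
  Additive.toMul ((η.app (LCat.mk e)).hom (Additive.ofMul x))

theorem natApp_mul {M N : StrictMod S} (η : (toFunctor S).obj M ⟶ (toFunctor S).obj N)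
    {e : Idem S} (x y : (unitalIdeal (M.alpha e))ˣ) :
    natApp η (x * y) = natApp η x * natApp η y := by
  exact congrArg (fun z : Additive (unitalIdeal (N.alpha e))ˣ => Additive.toMul z)
    (map_add (η.app (LCat.mk e)).hom (Additive.ofMul x) (Additive.ofMul y))

theorem natApp_one {M N : StrictMod S} (η : (toFunctor S).obj M ⟶ (toFunctor S).obj N)
    {e : Idem S} : natApp η (1 : (unitalIdeal (M.alpha e))ˣ) = 1 := by
  have h := natApp_mul η (1 : (unitalIdeal (M.alpha e))ˣ) 1
  rwa [one_mul, left_eq_mul] at h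

theorem natApp_lam {M N : StrictMod S} (η : (toFunctor S).obj M ⟶ (toFunctor S).obj N)
    (s : S) {e f : Idem S} (h : conj s e = f) (x : (unitalIdeal (M.alpha e))ˣ) :
    uval (natApp η (M.compMap s h x)) = N.lam s (uval (natApp η x)) := by
  have h1 := η.naturality (LCat.homMk s h)
  have h2 := congrArg (fun k => uval (Additive.toMul (k.hom (Additive.ofMul x)))) h1
  have h3 : M.compMap (s * e) (LCat.Hom.conj_el (LCat.homMk s h)) x = M.compMap s h x := by
    apply uval_injective
    change M.lam (s * e) (uval x) = M.lam s (uval x)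
    rw [M.str.lam_mul, M.str.lam_idem, idem_mul_uval]
  rw [← h3]
  refine h2.trans ?_
  change N.lam (s * e) _ = N.lam s _
  rw [N.str.lam_mul, N.str.lam_idem]
  exact congrArg _ (idem_mul_uval (natApp η x))

theorem natApp_congr {M N : StrictMod S} (η : (toFunctor S).obj M ⟶ (toFunctor S).obj N)
    {e f : Idem S} (h : e = f) (x : (unitalIdeal (M.alpha e))ˣ)
    (y : (unitalIdeal (M.alpha f))ˣ) (hxy : uval x = uval y) :
    uval (natApp η x) = uval (natApp η y) := by
  subst h
  rw [uval_injective hxy]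

/-- The element `a` as a unit of its component. -/
def unitOf (M : StrictMod S) (a : M) : (unitalIdeal (M.alpha (M.deg a)))ˣ :=
  toUnit a (M.rIdem_eq a)

@[simp] theorem uval_unitOf (M : StrictMod S) (a : M) : uval (M.unitOf a) = a := rfl

/-- The morphism given by a natural transformation of functors of components. -/
def ofNat {M N : StrictMod S} (η : (toFunctor S).obj M ⟶ (toFunctor S).obj N) : M ⟶ N :=
  (⟨⟨fun a => uval (natApp η (M.unitOf a)), fun a b => by
      have ha : conj (M.deg b : S) (M.deg a) = M.deg (a * b) := by
        rw [conj_idem, deg_mul, mul_comm]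
      have hb : conj (M.deg a : S) (M.deg b) = M.deg (a * b) := by
        rw [conj_idem, deg_mul]
      have h : M.unitOf (a * b) = M.compMap _ ha (M.unitOf a) * M.compMap _ hb (M.unitOf b) := by
        apply uval_injective
        change a * b = M.lam _ a * M.lam _ b
        rw [M.str.lam_idem, M.str.lam_idem, mul_mul_mul_comm, mul_comm (M.str.alpha _ : M),
          mul_mul_mul_comm, M.alpha_deg_mul, M.alpha_deg_mul]
      rw [h, natApp_mul, uval_mul, natApp_lam, natApp_lam, N.str.lam_idem, N.str.lam_idem,
        mul_mul_mul_comm, mul_comm (N.str.alpha _ : N), mul_mul_mul_comm]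
      exact congrArg₂ (· * ·) (idem_mul_uval _) (idem_mul_uval _)⟩,
    fun e => by
      change uval (natApp η (M.unitOf (M.alpha e))) = _
      rw [natApp_congr η (M.deg_alpha e) _ 1 rfl, natApp_one]
      rfl,
    fun s a => by
      change uval (natApp η (M.unitOf (M.lam s a))) = N.lam s (uval (natApp η (M.unitOf a)))
      rw [← natApp_lam η s rfl]
      exact natApp_congr η (M.deg_lam s a) _ _ rfl⟩ : Hom M N)

instance : (toFunctor S).Full where
  map_surjective {M N} η := ⟨ofNat η, by
    ext e x
    apply Additive.toMul.injective
    apply uval_injective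
    change uval (natApp η (M.unitOf (uval (Additive.toMul x)))) =
      uval (natApp η (Additive.toMul x))
    refine natApp_congr η ?_ _ _ rfl
    rw [deg_eq_iff, rIdem_uval]⟩

end StrictMod

namespace Components

variable {S : Type u} [Monoid S] [IsInverseSemigroup S]

/-- The components given by a functor. -/
def ofFunctor (F : LCat S ⥤ AddCommGrpCat.{u}) : Components S where
  X e := F.obj (LCat.mk e)
  act s _ _ h := (F.map (LCat.homMk s h)).hom
  act_idem {e f} h a := by
    have : LCat.homMk (f : S) h = 𝟙 _ := LCat.hom_ext (by
      rw [LCat.el_homMk, LCat.el_id, ← Idem.coe_mul, ← conj_idem, h])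
    rw [this, F.map_id]
    rfl
  act_mul s t {e f g} h₁ h₂ h₃ a := by
    have : LCat.homMk (s * t) h₃ = LCat.homMk t h₁ ≫ LCat.homMk s h₂ := LCat.hom_ext (by
      have ht : t * (e : S) = (f : S) * (t * e) := by
        rw [← h₁, coe_conj]
        calc t * (e : S) = (t * sinv t * t) * (e * e) := by rw [mul_sinv_mul, e.2]
          _ = t * ((sinv t * t) * e) * e := by simp only [mul_assoc]
          _ = t * (e * (sinv t * t)) * e := by rw [IdemComm.comm _ _ (sinv_mul_idem t) e.2]
          _ = t * e * sinv t * (t * e) := by simp only [mul_assoc]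
      rw [LCat.el_comp, LCat.el_homMk, LCat.el_homMk, LCat.el_homMk, mul_assoc, mul_assoc, ← ht])
    rw [this, F.map_comp]
    rfl

theorem Total.mk_act {L : Components S} (s : S) {e f : Idem S} (h : conj s e = f) (a : L.X e) :
    (⟨conj s e, L.act s rfl a⟩ : L.Total) = ⟨f, L.act s h a⟩ := by
  subst h
  rfl

theorem rIdem_toStrictModEl (L : Components S) {e : Idem S} (a : L.X e) :
    rIdem (L.toStrictModEl a) = L.toStrictMod.alpha e := by
  rw [← StrictMod.deg_eq_iff, deg_toStrictModEl]

/-- The isomorphism between a component of `L.toStrictMod` and `L.X e`. -/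
def compEquiv (L : Components S) (e : Idem S) :
    L.X e ≃+ Additive (unitalIdeal (L.toStrictMod.alpha e))ˣ :=
  AddEquiv.ofBijective
    (({ toFun := fun a => Additive.ofMul (toUnit (L.toStrictModEl a) (L.rIdem_toStrictModEl a))
        map_zero' := by
          apply Additive.toMul.injective
          apply uval_injective
          rfl
        map_add' := fun a b => by
          apply Additive.toMul.injective
          apply uval_injective
          exact (Total.mk_mul_mk e a b).symm } :
      L.X e →+ Additive (unitalIdeal (L.toStrictMod.alpha e))ˣ)) (by
    constructor
    · intro a b h
      have h1 := congrArg (fun x => uval (Additive.toMul x)) h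
      have h2 : (⟨e, a⟩ : L.Total) = ⟨e, b⟩ := h1
      rw [Total.mk.injEq] at h2
      exact eq_of_heq h2.2
    · intro x
      have h1 : L.toStrictMod.deg (uval (Additive.toMul x)) = e := by
        rw [StrictMod.deg_eq_iff, rIdem_uval]
      obtain ⟨⟨f, a⟩, hp⟩ : ∃ p : L.Total, p = uval (Additive.toMul x) := ⟨_, rfl⟩
      rw [← hp] at h1
      have h2 : f = e := (L.deg_toStrictModEl a).symm.trans h1
      subst h2
      refine ⟨a, ?_⟩
      apply Additive.toMul.injective
      apply uval_injective
      exact hp)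

end Components

namespace StrictMod

variable {S : Type u} [Monoid S] [IsInverseSemigroup S]

instance : (toFunctor S).EssSurj where
  mem_essImage F := ⟨(Components.ofFunctor F).toStrictMod, ⟨
    (NatIso.ofComponents (fun e => ((Components.ofFunctor F).compEquiv e.idem).toAddCommGrpIso)
      (by
        rintro ⟨e⟩ ⟨f⟩ p
        ext a
        apply Additive.toMul.injective
        apply uval_injective
        have hp : conj (LCat.Hom.el p) e = f := LCat.Hom.conj_el p
        have h : p = LCat.homMk (LCat.Hom.el p) hp :=
          LCat.hom_ext (LCat.Hom.el_mul p).symm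
        have h2 : (⟨f, (F.map p).hom a⟩ : (Components.ofFunctor F).Total) =
            ⟨f, (Components.ofFunctor F).act (LCat.Hom.el p) hp a⟩ :=
          congrArg (fun q => (⟨f, (F.map q).hom a⟩ : (Components.ofFunctor F).Total)) h
        have h3 := (Components.Total.mk_act (L := Components.ofFunctor F) (LCat.Hom.el p) hp a).symm
        change (⟨f, (F.map p).hom a⟩ : (Components.ofFunctor F).Total) =
          (Components.ofFunctor F).totalLam (LCat.Hom.el p) ⟨e, a⟩
        exact h2.trans h3)).symm⟩⟩

instance : (toFunctor S).IsEquivalence where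

instance : Limits.HasFiniteProducts (StrictMod S) :=
  ⟨fun _ => Adjunction.hasLimitsOfShape_of_equivalence (toFunctor S)⟩

/-- The category of strict inverse `S`-modules is abelian. -/
instance : Abelian (StrictMod S) := abelianOfEquivalence (toFunctor S)

instance : HasExt.{u + 1} (StrictMod S) := HasExt.standard _

end StrictMod

/-! ### The trivial module and free modules -/

section Free

variable {S : Type u} [Monoid S] [IsInverseSemigroup S]

/-- The trivial module `Z_S`: all components are `ℤ`, i.e. it consists of elements `n_e` with
`n_e + m_f = (n + m)_{ef}`, `λ_s(n_e) = n_{s e s⁻¹}` and `α(e) = 0_e`. -/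
def trivialComponents (S : Type u) [Monoid S] [IsInverseSemigroup S] : Components S where
  X _ := ULift.{u} ℤ
  act _ _ _ _ := AddMonoidHom.id _
  act_idem _ _ := rfl
  act_mul _ _ _ _ _ _ _ _ _ := rfl

/-- The trivial module `Z_S`. -/
def trivialMod (S : Type u) [Monoid S] [IsInverseSemigroup S] : StrictMod S :=
  (trivialComponents S).toStrictMod

/-- The element `n_e` of `Z_S`. -/
def trivialEl (n : ℤ) (e : Idem S) : trivialMod S :=
  (trivialComponents S).toStrictModEl (e := e) (ULift.up n)

/-- A (strict) `E(S)`-set: a disjoint union of sets indexed by `E(S)`; `deg t` is the index of the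
component of `t`. -/
structure IdemSet (S : Type u) [Monoid S] [IsInverseSemigroup S] where
  X : Type u
  deg : X → Idem S

/-- The basis of the component `F(T)_e` of the free module: pairs `(s, t)` with `s s⁻¹ = e` and
`s⁻¹ s ≤ f` for the index `f` of the component of `t`. -/
@[ext] structure FreeBasis (T : IdemSet S) (e : Idem S) where
  s : S
  t : T.X
  target : rIdem s = e
  source : sinv s * s * T.deg t = sinv s * s

/-- The map `(s', t) ↦ (s s', t)`. -/
def FreeBasis.act {T : IdemSet S} (s : S) {e f : Idem S} (h : conj s e = f)
    (b : FreeBasis T e) : FreeBasis T f where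
  s := s * b.s
  t := b.t
  target := by
    have h1 : rIdem (s * b.s) = conj s (rIdem b.s) := by
      ext
      simp only [coe_rIdem, coe_conj, sinv_mul, mul_assoc]
    rw [h1, b.target, h]
  source := by
    have h1 : b.s * T.deg b.t = b.s := by
      calc b.s * T.deg b.t = b.s * (sinv b.s * b.s * T.deg b.t) := by
            simp only [← mul_assoc, mul_sinv_mul]
        _ = b.s := by rw [b.source, ← mul_assoc, mul_sinv_mul]
    rw [mul_assoc, mul_assoc s, h1]

theorem FreeBasis.s_mul_deg {T : IdemSet S} {e : Idem S} (b : FreeBasis T e) :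
    b.s * T.deg b.t = b.s := by
  calc b.s * T.deg b.t = b.s * (sinv b.s * b.s * T.deg b.t) := by
        simp only [← mul_assoc, mul_sinv_mul]
    _ = b.s := by rw [b.source, ← mul_assoc, mul_sinv_mul]

/-- The components of the free module: `F(T)_e` is the free abelian group on `FreeBasis T e`, and
`s ∈ S` acts by `(s', t) ↦ (s s', t)`. -/
def freeComponents (T : IdemSet S) : Components S where
  X e := FreeAbelianGroup (FreeBasis T e)
  act s _ _ h := FreeAbelianGroup.map (FreeBasis.act s h)
  act_idem {e f} h a := by
    have : (FreeBasis.act (f : S) h : FreeBasis T e → FreeBasis T e) = id := by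
      funext b
      refine FreeBasis.ext ?_ rfl
      have h1 : (f : S) * e = e := by rw [← Idem.coe_mul, ← conj_idem, h]
      change (f : S) * b.s = b.s
      rw [← rIdem_mul_self b.s, b.target, ← mul_assoc, h1]
    rw [this, FreeAbelianGroup.map_id_apply]
  act_mul s t {e f g} h₁ h₂ h₃ a := by
    have : (FreeBasis.act (s * t) h₃ : FreeBasis T e → FreeBasis T g) =
        FreeBasis.act s h₂ ∘ FreeBasis.act t h₁ := by
      funext b
      exact FreeBasis.ext (mul_assoc _ _ _) rfl
    rw [this, FreeAbelianGroup.map_comp_apply]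

/-- The free strict inverse module `F(T)`. -/
def freeMod (T : IdemSet S) : StrictMod S := (freeComponents T).toStrictMod

/-- The embedding `T → F(T)`, `T_e ∋ t ↦ (e, t)`. -/
def freeBasisι (T : IdemSet S) (t : T.X) : FreeBasis T (T.deg t) where
  s := T.deg t
  t := t
  target := rIdem_idem _
  source := by rw [sinv_idem (T.deg t).2, (T.deg t).2, (T.deg t).2]

/-- The embedding `T → F(T)`, `T_e ∋ t ↦ (e, t)`. -/
def freeι (T : IdemSet S) (t : T.X) : freeMod T :=
  (freeComponents T).toStrictModEl (FreeAbelianGroup.of (freeBasisι T t))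

theorem deg_freeι (T : IdemSet S) (t : T.X) : (freeMod T).deg (freeι T t) = T.deg t :=
  Components.deg_toStrictModEl _

theorem rIdem_lam {M : StrictMod S} {T : IdemSet S} (φ : T.X → M)
    (hφ : ∀ t, M.deg (φ t) = T.deg t) {e : Idem S} (b : FreeBasis T e) :
    rIdem (M.lam b.s (φ b.t)) = M.alpha e := by
  rw [← M.deg_eq_iff, M.deg_lam, hφ, conj_eq_rIdem b.s_mul_deg, b.target]

/-- The morphism `F(T) → M` that extends a morphism `φ : T → M` of `E(S)`-sets; it sends
`(s, t)` to `λ_s(φ(t))`. -/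
def freeLift {M : StrictMod S} {T : IdemSet S} (φ : T.X → M)
    (hφ : ∀ t, M.deg (φ t) = T.deg t) : freeMod T ⟶ M :=
  Components.homMk
    (fun e => FreeAbelianGroup.lift fun b : FreeBasis T e =>
      Additive.ofMul (toUnit (M.lam b.s (φ b.t)) (rIdem_lam φ hφ b)))
    (fun s e a => by
      have h : (FreeAbelianGroup.lift fun b : FreeBasis T (conj s e) =>
            Additive.ofMul (toUnit (M.lam b.s (φ b.t)) (rIdem_lam φ hφ b))).comp
            ((freeComponents T).act s rfl) =
          (MonoidHom.toAdditive (M.compMap s rfl)).comp (FreeAbelianGroup.lift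
            fun b : FreeBasis T e =>
              Additive.ofMul (toUnit (M.lam b.s (φ b.t)) (rIdem_lam φ hφ b))) := by
        refine FreeAbelianGroup.lift_ext _ _ fun b => ?_
        apply Additive.toMul.injective
        apply uval_injective
        change uval (Additive.toMul (FreeAbelianGroup.lift _
          (FreeAbelianGroup.map _ (FreeAbelianGroup.of b)))) =
            M.lam s (uval (Additive.toMul (FreeAbelianGroup.lift _ (FreeAbelianGroup.of b))))
        rw [FreeAbelianGroup.map_of_apply, FreeAbelianGroup.lift_apply_of,
          FreeAbelianGroup.lift_apply_of]
        exact M.str.lam_mul _ _ _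
      exact congrArg (fun k => uval (Additive.toMul (k a))) h)

theorem freeLift_ι {M : StrictMod S} {T : IdemSet S} (φ : T.X → M)
    (hφ : ∀ t, M.deg (φ t) = T.deg t) (t : T.X) :
    StrictMod.Hom.app (freeLift φ hφ) (freeι T t) = φ t := by
  refine (congrArg (fun k => uval (Additive.toMul k)) (FreeAbelianGroup.lift_apply_of
    (fun b : FreeBasis T (T.deg t) =>
      Additive.ofMul (toUnit (M.lam b.s (φ b.t)) (rIdem_lam φ hφ b))) (freeBasisι T t))).trans ?_
  change M.lam (T.deg t) (φ t) = φ t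
  rw [M.str.lam_idem, ← hφ t, M.alpha_deg_mul]

end Free

/-! ### The modules `R_n` and the maps `∂_n` -/

section Resolution

variable {G : Type u} [Group G] {S : Type u} [Monoid S] [IsInverseSemigroup S]
  (π : ExelMonoid G →* S)

/-- `Γ(x) = π([x])`. -/
def Gam (x : G) : S := π (ExelMonoid.gen x)

/-- `ε_x = Γ(x) Γ(x)⁻¹`. -/
def epsS (x : G) : Idem S := rIdem (Gam π x)

/-- `ε_{(x₁,…,xₙ)} = ε_{x₁} ε_{x₁x₂} ⋯ ε_{x₁⋯xₙ}`; it is `1` for `n = 0`. -/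
def epsTuple {n : ℕ} (x : Fin n → G) : Idem S := tupleIdem (epsS π) x

theorem sinv_Gam (x : G) : sinv (Gam π x) = Gam π x⁻¹ := by
  unfold Gam
  symm
  apply eq_sinv
  · rw [← map_mul, ← map_mul, ExelMonoid.gen_inv_gen]
  · have := ExelMonoid.gen_inv_gen x⁻¹
    rw [inv_inv] at this
    rw [← map_mul, ← map_mul, this]

theorem coe_epsS (x : G) : (epsS π x : S) = π (ExelMonoid.eps x) := by
  change Gam π x * sinv (Gam π x) = _
  rw [sinv_Gam, ExelMonoid.eps, map_mul]
  rfl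

theorem conj_epsS (x y : G) : conj (Gam π x) (epsS π y) = epsS π x * epsS π (x * y) := by
  ext
  rw [coe_conj, sinv_Gam, Idem.coe_mul, coe_epsS, coe_epsS, coe_epsS, Gam, Gam, ← map_mul,
    ← map_mul, ← map_mul, ExelMonoid.gen_mul_eps, mul_assoc, ExelMonoid.eps_comm]
  rfl

theorem conj_epsS_prod (x : G) {ι : Type*} (s : Finset ι) (y : ι → G) :
    conj (Gam π x) (∏ i ∈ s, epsS π (y i)) = epsS π x * ∏ i ∈ s, epsS π (x * y i) := by
  classical
  induction s using Finset.induction_on with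
  | empty =>
    rw [Finset.prod_empty, Finset.prod_empty, mul_one, conj_eq_rIdem (by simp)]
    rfl
  | insert a s ha ih =>
    rw [Finset.prod_insert ha, Finset.prod_insert ha, conj_mul_idem, ih, conj_epsS,
      mul_mul_mul_comm, Idem.mul_self]

theorem conj_epsTuple {n : ℕ} (x : Fin (n + 1) → G) :
    conj (Gam π (x 0)) (epsTuple π (Fin.tail x)) = epsTuple π x := by
  unfold epsTuple
  rw [tupleIdem_succ]
  exact conj_epsS_prod π _ _ _

/-- The `E(S)`-set `V_n`: the set `Gⁿ`, in which `(x₁,…,xₙ)` lies in the component with index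
`ε_{(x₁,…,xₙ)}`. -/
def V (n : ℕ) : IdemSet S where
  X := Fin n → G
  deg := epsTuple π

/-- The free module `R_n` over `V_n`. -/
def R (n : ℕ) : StrictMod S := freeMod (V π n)

/-- The basis element `(Γ(x₁) ε_{(x₂,…,xₙ₊₁)}, (x₂,…,xₙ₊₁))` of `R_n`. -/
def bdryFirst {n : ℕ} (x : Fin (n + 1) → G) : FreeBasis (V π n) (epsTuple π x) where
  s := Gam π (x 0) * epsTuple π (Fin.tail x)
  t := Fin.tail x
  target := by
    rw [← conj_epsTuple, ← conj_eq_rIdem (e := epsTuple π (Fin.tail x)) (by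
      rw [mul_assoc, Idem.mul_self_val]), conj_mul, conj_idem, Idem.mul_self]
  source := by
    change _ * (epsTuple π (Fin.tail x) : S) = _
    rw [mul_assoc, mul_assoc, Idem.mul_self_val]

/-- The basis element `(ε_{(x₁,…,xₙ₊₁)}, y)` of `R_n`, where `y = (x₁,…,xᵢxᵢ₊₁,…,xₙ₊₁)` for
`i = j + 1 ≤ n`, and `y = (x₁,…,xₙ)` for `j = n`. -/
def bdryContract {n : ℕ} (x : Fin (n + 1) → G) (j : Fin (n + 1)) :
    FreeBasis (V π n) (epsTuple π x) where
  s := epsTuple π x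
  t := Fin.contractNth j (· * ·) x
  target := rIdem_idem _
  source := by
    change _ * (epsTuple π (Fin.contractNth j (· * ·) x) : S) = _
    rw [sinv_idem (Idem.mul_self_val _), Idem.mul_self_val, ← Idem.coe_mul]
    unfold epsTuple
    rw [tupleIdem_mul_self _ Idem.mul_self]

/-- The value `∂_{n+1}(x₁,…,xₙ₊₁)`, an element of the component of `R_n` with index
`ε_{(x₁,…,xₙ₊₁)}`. -/
def bdryValue {n : ℕ} (x : Fin (n + 1) → G) :
    (freeComponents (V π n)).X (epsTuple π x) :=
  (FreeAbelianGroup.of (bdryFirst π x) + ∑ j : Fin (n + 1),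
    ((-1 : ℤ) ^ ((j : ℕ) + 1)) • FreeAbelianGroup.of (bdryContract π x j) :
      FreeAbelianGroup (FreeBasis (V π n) (epsTuple π x)))

/-- The morphism `∂_{n+1} : R_{n+1} → R_n`. -/
def bdry (n : ℕ) : R π (n + 1) ⟶ R π n :=
  freeLift (T := V π (n + 1)) (fun x => (freeComponents (V π n)).toStrictModEl (bdryValue π x))
    (fun _ => Components.deg_toStrictModEl _)

/-- The morphism `∂_0 : R_0 → Z_S` with `∂_0() = 1_{1_S}`. -/
def bdryZero : R π 0 ⟶ trivialMod S :=
  freeLift (T := V π 0) (fun _ => trivialEl 1 1) (fun _ => Components.deg_toStrictModEl _)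

/-- The coboundary `f ↦ f ∘ ∂_{n+1}` on `Hom(R_•, A)`. -/
def homCoboundary (A : StrictMod S) (n : ℕ) : (R π n ⟶ A) →+ (R π (n + 1) ⟶ A) where
  toFun f := bdry π n ≫ f
  map_zero' := Limits.comp_zero
  map_add' f g := Preadditive.comp_add _ _ _ _ f g

end Resolution

/-! ### Epi-strict modules -/

section EpiStrict

/-- An epimorphism `π : T → S` onto an inverse monoid. -/
structure EpiImage (T : Type u) [Monoid T] [IsInverseSemigroup T] where
  S : Type u
  [monoid : Monoid S]
  [isInverse : IsInverseSemigroup S]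
  π : T →* S
  surjective : Function.Surjective π

variable {T : Type u} [Monoid T] [IsInverseSemigroup T]

instance (I : EpiImage T) : Monoid I.S := I.monoid

instance (I : EpiImage T) : IsInverseSemigroup I.S := I.isInverse

/-- An inverse epi-strict `T`-module `(A, π : T → S)`: a strict inverse module `A` over `S`. -/
structure EpiStrictMod (T : Type u) [Monoid T] [IsInverseSemigroup T] where
  img : EpiImage T
  mod : StrictMod img.S

/-- An epi-strict `E(T)`-set `(X, π : T → S)`: an `E(S)`-set `X`. -/
structure EpiStrictSet (T : Type u) [Monoid T] [IsInverseSemigroup T] where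
  img : EpiImage T
  set : IdemSet img.S

/-- Morphisms of epi-strict modules: pairs `(φ, ψ)` with `ψ ∘ π' = π''`. -/
@[ext] structure EpiStrictMod.Hom (M N : EpiStrictMod T) where
  φ : M.mod →ₙ* N.mod
  ψ : M.img.S →* N.img.S
  comp_eq : ψ.comp M.img.π = N.img.π
  map_alpha : ∀ e : Idem M.img.S, φ (M.mod.alpha e) = N.mod.alpha (Idem.map ψ e)
  map_lam : ∀ (s : M.img.S) (a : M.mod), φ (M.mod.lam s a) = N.mod.lam (ψ s) (φ a)

/-- Morphisms of epi-strict sets: pairs `(φ, ψ)` with `ψ ∘ π' = π''` and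
`φ(X'_e) ⊆ X''_{ψ(e)}`. -/
@[ext] structure EpiStrictSet.Hom (X Y : EpiStrictSet T) where
  φ : X.set.X → Y.set.X
  ψ : X.img.S →* Y.img.S
  comp_eq : ψ.comp X.img.π = Y.img.π
  map_deg : ∀ t, Y.set.deg (φ t) = Idem.map ψ (X.set.deg t)

instance : Category (EpiStrictMod T) where
  Hom := EpiStrictMod.Hom
  id M := ⟨MulHom.id _, MonoidHom.id _, rfl, fun _ => rfl, fun _ _ => rfl⟩
  comp f g := ⟨g.φ.comp f.φ, g.ψ.comp f.ψ,
    by rw [MonoidHom.comp_assoc, f.comp_eq, g.comp_eq],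
    fun e => by rw [MulHom.comp_apply, f.map_alpha, g.map_alpha]; rfl,
    fun s a => by rw [MulHom.comp_apply, f.map_lam, g.map_lam]; rfl⟩

instance : Category (EpiStrictSet T) where
  Hom := EpiStrictSet.Hom
  id X := ⟨id, MonoidHom.id _, rfl, fun _ => rfl⟩
  comp f g := ⟨g.φ ∘ f.φ, g.ψ.comp f.ψ,
    by rw [MonoidHom.comp_assoc, f.comp_eq, g.comp_eq],
    fun t => by rw [Function.comp_apply, g.map_deg, f.map_deg]; rfl⟩

/-- The epi-strict set underlying an inverse epi-strict module `A`, with components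
`A_e = {a | a a⁻¹ = α(e)}`. -/
def EpiStrictMod.toSet (M : EpiStrictMod T) : EpiStrictSet T where
  img := M.img
  set := ⟨M.mod, M.mod.deg⟩

theorem EpiStrictMod.deg_map {M N : EpiStrictMod T} (f : M ⟶ N) (a : M.mod) :
    N.mod.deg (EpiStrictMod.Hom.φ f a) = Idem.map (EpiStrictMod.Hom.ψ f) (M.mod.deg a) := by
  rw [StrictMod.deg_eq_iff]
  ext
  have h := EpiStrictMod.Hom.map_alpha f (M.mod.deg a)
  rw [M.mod.alpha_deg] at h
  rw [← h, coe_rIdem, coe_rIdem, ← map_sinv, ← map_mul]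

/-- A morphism of epi-strict modules is a morphism of the underlying sets. -/
def EpiStrictMod.Hom.toSetHom {M N : EpiStrictMod T} (f : M ⟶ N) : M.toSet ⟶ N.toSet :=
  (⟨EpiStrictMod.Hom.φ f, EpiStrictMod.Hom.ψ f, EpiStrictMod.Hom.comp_eq f,
    EpiStrictMod.deg_map f⟩ : EpiStrictSet.Hom M.toSet N.toSet)

/-- `F` is free over the epi-strict set `X` with respect to `ι : X → F`. -/
def EpiStrictMod.IsFreeOn {F : EpiStrictMod T} {X : EpiStrictSet T} (ι : X ⟶ F.toSet) : Prop :=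
  ∀ (A : EpiStrictMod T) (f : X ⟶ A.toSet),
    ∃! g : F ⟶ A, ι ≫ EpiStrictMod.Hom.toSetHom g = f

/-- An epi-strict module `(A, π : T → S)` is standard if it is isomorphic to one obtained as
follows: take a `T`-module `(B, λ, α)` with `α` surjective; let `S' ⊆ B ⋊ T` be the image of the
homomorphism `π' : T → B ⋊ T`, `t ↦ [α(t t⁻¹) δ_t]`, and view `B` as the strict `S'`-module
`(B, λ', α')` with `λ' ∘ π' = λ` and `α' ∘ π' = α`.  Here `φ : A → B` and the corestriction
`S → S'` of `ψ` form such an isomorphism. -/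
def EpiStrictMod.IsStandard (M : EpiStrictMod T) : Prop :=
  ∃ (B : Type u) (_ : CommMonoid B) (N : SModule T B), Function.Surjective N.alpha ∧
    ∃ (φ : M.mod ≃* B) (ψ : M.img.S →ₙ* N.Semidirect), Function.Injective ψ ∧
      (∀ t : T, ψ (M.img.π t) = N.toSemidirect t) ∧
      (∀ e : Idem T, φ (M.mod.alpha (Idem.map M.img.π e)) = N.alpha e) ∧
      ∀ (t : T) (a : M.mod), φ (M.mod.lam (M.img.π t) a) = N.lam t (φ a)

/-- The cohomology group `Hⁿ(T, A) = Hⁿ_S(A) = Extⁿ_S(Z_S, A)` of `T` with values in an inverse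
epi-strict module `(A, π : T → S)`; `Ext` is taken in the abelian category of strict inverse
`S`-modules. -/
abbrev EpiStrictMod.Cohomology (M : EpiStrictMod T) (n : ℕ) : Type (u + 1) :=
  Abelian.Ext.{u + 1} (trivialMod M.img.S) M.mod n

end EpiStrict

section Induced

variable {G : Type u} [Group G] (M : EpiStrictMod (ExelMonoid G))

/-- The epi-strict module `M` induces the partial `G`-module structure `θ` on its underlying monoid:
`α(π(ε_x)) = 1_x` and `λ_{π([x])}(a) = θ_x(1_{x⁻¹} a)`. -/
def EpiStrictMod.Induces (P : PartialModule G M.mod) : Prop :=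
  (∀ x : G, M.mod.alpha (epsS M.img.π x) = P.idem x) ∧
    ∀ (x : G) (a : M.mod), M.mod.lam (M.img.π (ExelMonoid.gen x)) a = P.act x a

/-- The free module `R_n` as an epi-strict module. -/
def EpiStrictMod.R (I : EpiImage (ExelMonoid G)) (n : ℕ) : EpiStrictMod (ExelMonoid G) :=
  ⟨I, PartialCohomology.R I.π n⟩

/-- The `E(S)`-set `V_n` as an epi-strict set. -/
def EpiStrictSet.V (I : EpiImage (ExelMonoid G)) (n : ℕ) : EpiStrictSet (ExelMonoid G) :=
  ⟨I, PartialCohomology.V I.π n⟩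

/-- The embedding `V_n → R_n`, `v ↦ (ε_v, v)`. -/
def resolutionι (I : EpiImage (ExelMonoid G)) (n : ℕ) :
    EpiStrictSet.V I n ⟶ (EpiStrictMod.R I n).toSet :=
  (⟨freeι (PartialCohomology.V I.π n), MonoidHom.id _, rfl, fun t => deg_freeι _ t⟩ :
    EpiStrictSet.Hom (EpiStrictSet.V I n) (EpiStrictMod.R I n).toSet)

end Induced

end PartialCohomology

end

open PartialCohomology

/-! Standardness contributes one fact: the degree map `[x] ↦ x` from `S(G)` to `G` factors through
`π` as some `σ : S → G` (`EpiStrictMod.IsStandard.exists_grading`). Indeed, the congruence defining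
`B ⋊ S(G)` is generated by pairs of symbols whose second entries differ by an idempotent factor, and
idempotents have degree `1`. Since every element of `S(G)` is an idempotent times a generator, every
`s` in `S` equals `s s⁻¹ Γ(σ(s))` (`rIdem_mul_Gam`). So `s` can be recovered from `s s⁻¹` and
`σ(s)`.

This makes `R_•` behave like the bar resolution of a group. In each component, `h(s, (x₁,…,xₙ)) = (s
s⁻¹, (σ(s), x₁,…,xₙ))` defines an additive contracting homotopy, not compatible with the action of
`S`. The leading face of `h(b)` is `b` because `s s⁻¹ Γ(σ(s)) = s`, and the other faces cancel
against `h(∂b)` (`bdryX_contr_succ`, `bdryX_contr_zero`). No double sum is needed for `∂∂ = 0`: the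
image of `h` generates `R_{n+1}` over `S`, and the homotopy identity gives `∂∂h = h∂∂`, so induction
on the degree applies (`bdry_comp_bdry`). Exactness then follows from the homotopy, one component at
a time.

Morphisms preserve components, so a morphism `R_n → A` amounts to a choice, for every tuple `x`, of
an element of `A` in the component of index `ε_x`. As `α(ε_x) = 1_x` for `x` in `G`, such a choice
is exactly a cochain (`cochainEquiv`). As `λ_{Γ(x)}` is `a ↦ θ_x(1_{x⁻¹} a)`, the faces of `∂`
become the factors of `δ` (`cochainEquiv_coboundary`).

Free modules are projective because epimorphisms are surjective, so `R_•` is a projective resolution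
of `Z_S` and computes `Ext`. Freeness among epi-strict modules allows the acting monoid to change
along `ψ : S → S''`. It reduces to freeness over the fixed `S` by replacing `A` with the `S`-module
whose components are `A_{ψ(e)}` (`isFreeOn_freeMod`). -/

noncomputable section

namespace PartialCohomology

/-! ### Epimorphisms and surjectivity -/

namespace StrictMod

variable {S : Type u} [Monoid S] [IsInverseSemigroup S]

theorem epi_of_surjective {M N : StrictMod S} (f : M ⟶ N)
    (hf : Function.Surjective (Hom.app f)) : Epi f where
  left_cancellation g h w := hom_ext fun b => by
    obtain ⟨a, rfl⟩ := hf b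
    exact congrArg (fun k => Hom.app k a) w

/-- Under the equivalence `toFunctor` with a functor category, epimorphisms become pointwise
epimorphisms of abelian groups, which are surjective. The component to look at for `b` is the one of
index `N.deg b`. -/
theorem surjective_of_epi {M N : StrictMod S} (f : M ⟶ N) [Epi f] :
    Function.Surjective (Hom.app f) := by
  intro b
  have h1 : Epi ((toFunctor S).map f) := inferInstance
  rw [NatTrans.epi_iff_epi_app] at h1
  have h2 := (AddCommGrpCat.epi_iff_surjective _).1 (h1 (LCat.mk (N.deg b)))
  obtain ⟨a, ha⟩ := h2 (Additive.ofMul (N.unitOf b))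
  exact ⟨uval (Additive.toMul a), congrArg (fun k => uval (Additive.toMul k)) ha⟩

end StrictMod

open StrictMod

/-! ### Morphisms and exactness, component by component -/

namespace Components

variable {S : Type u} [Monoid S] [IsInverseSemigroup S] (L : Components S)

theorem toStrictModEl_add {e : Idem S} (a b : L.X e) :
    L.toStrictModEl (a + b) = L.toStrictModEl a * L.toStrictModEl b :=
  (Total.mk_mul_mk e a b).symm

theorem toStrictModEl_neg {e : Idem S} (a : L.X e) :
    L.toStrictModEl (-a) = sinv (L.toStrictModEl a) :=
  (Total.sinv_def (L := L) ⟨e, a⟩).symm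

theorem lam_toStrictModEl (s : S) {e f : Idem S} (h : conj s e = f) (a : L.X e) :
    L.toStrictMod.lam s (L.toStrictModEl a) = L.toStrictModEl (L.act s h a) :=
  Total.mk_act s h a

theorem toStrictModEl_injective {e : Idem S} :
    Function.Injective (L.toStrictModEl (e := e)) := by
  intro a b h
  have h2 : (⟨e, a⟩ : L.Total) = ⟨e, b⟩ := h
  rw [Total.mk.injEq] at h2
  exact eq_of_heq h2.2

/-- Indexing the component by `deg p` lets later proofs move between components by substituting an
equation of degrees. -/
theorem exists_toStrictModEl (p : L.toStrictMod) : ∃ a : L.X (L.toStrictMod.deg p),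
    L.toStrictModEl a = p := by
  obtain ⟨e, a⟩ := p
  have h : L.toStrictMod.deg (⟨e, a⟩ : L.Total) = e := L.deg_toStrictModEl a
  rw [h]
  exact ⟨a, rfl⟩

/-- The components `X_e → M_e` of a morphism. -/
def homUnits {M : StrictMod S} (f : L.toStrictMod ⟶ M) (e : Idem S) :
    L.X e →+ Additive (unitalIdeal (M.alpha e))ˣ :=
  (MonoidHom.toAdditive (homComp f e)).comp (L.compEquiv e).toAddMonoidHom

variable {L} {K N : Components S}

/-- The components `X_e → Y_e` of a morphism between modules given by their components. -/
def homX (f : K.toStrictMod ⟶ L.toStrictMod) (e : Idem S) : K.X e →+ L.X e :=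
  (L.compEquiv e).symm.toAddMonoidHom.comp (K.homUnits f e)

theorem app_toStrictModEl (f : K.toStrictMod ⟶ L.toStrictMod) {e : Idem S} (a : K.X e) :
    Hom.app f (K.toStrictModEl a) = L.toStrictModEl (homX f e a) := by
  have h : L.compEquiv e (homX f e a) = K.homUnits f e a :=
    (L.compEquiv e).apply_symm_apply _
  exact (congrArg (fun k => uval (Additive.toMul k)) h).symm

theorem homX_eq_iff (f : K.toStrictMod ⟶ L.toStrictMod) {e : Idem S} (a : K.X e) (b : L.X e) :
    homX f e a = b ↔ Hom.app f (K.toStrictModEl a) = L.toStrictModEl b := by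
  rw [app_toStrictModEl, L.toStrictModEl_injective.eq_iff]

theorem homX_act (f : K.toStrictMod ⟶ L.toStrictMod) (s : S) {e e' : Idem S}
    (h : conj s e = e') (a : K.X e) :
    homX f e' (K.act s h a) = L.act s h (homX f e a) := by
  rw [homX_eq_iff, ← lam_toStrictModEl, Hom.app_lam, app_toStrictModEl, lam_toStrictModEl _ _ h]

/-- Morphisms preserve degrees, so kernel and image are the disjoint unions of the kernels and
images of the component maps. This turns exactness of modules into exactness of abelian groups,
where a homotopy that ignores the action of `S` can be used. -/
theorem kernel_eq_image_iff (f : K.toStrictMod ⟶ L.toStrictMod)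
    (g : L.toStrictMod ⟶ N.toStrictMod) :
    Hom.kernel g = Hom.image f ↔ ∀ e, Function.Exact (homX f e) (homX g e) := by
  constructor
  · intro h e a
    have h1 := Set.ext_iff.1 h (L.toStrictModEl a)
    constructor
    · intro ha
      obtain ⟨p, hp⟩ := h1.1 ⟨e, by rw [app_toStrictModEl, ha]; rfl⟩
      have hd : K.toStrictMod.deg p = e := by
        rw [← deg_app f, hp, deg_toStrictModEl]
      obtain ⟨b, hb⟩ := K.exists_toStrictModEl p
      subst hd
      exact ⟨b, (homX_eq_iff _ _ _).2 (by rw [hb, hp])⟩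
    · rintro ⟨b, rfl⟩
      obtain ⟨e', he'⟩ := h1.2 ⟨K.toStrictModEl b, app_toStrictModEl f b⟩
      -- Membership in the kernel only supplies some index `e'`; comparing degrees identifies it
      -- with `e`.
      have hd : e = e' := by
        rw [← deg_alpha N.toStrictMod e', ← he', deg_app, deg_toStrictModEl]
      subst hd
      rw [homX_eq_iff, he']
      rfl
  · intro h
    ext p
    constructor
    · rintro ⟨e, he⟩
      have hd : L.toStrictMod.deg p = e := by
        rw [← deg_app g, he, deg_alpha]
      obtain ⟨a, ha⟩ := L.exists_toStrictModEl p
      subst hd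
      obtain ⟨b, hb⟩ := (h _ a).1 ((homX_eq_iff _ _ _).2 (by rw [ha, he]; rfl))
      exact ⟨K.toStrictModEl b, by rw [app_toStrictModEl, hb, ha]⟩
    · rintro ⟨p, rfl⟩
      obtain ⟨a, ha⟩ := K.exists_toStrictModEl p
      refine ⟨K.toStrictMod.deg p, ?_⟩
      rw [← ha, app_toStrictModEl, app_toStrictModEl, (h _ _).2 ⟨a, rfl⟩, ha]
      rfl

theorem image_eq_univ_iff (f : K.toStrictMod ⟶ L.toStrictMod) :
    Hom.image f = Set.univ ↔ ∀ e, Function.Surjective (homX f e) := by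
  constructor
  · intro h e a
    obtain ⟨p, hp⟩ : L.toStrictModEl a ∈ Hom.image f := by rw [h]; trivial
    have hd : K.toStrictMod.deg p = e := by
      rw [← deg_app f, hp, deg_toStrictModEl]
    obtain ⟨b, hb⟩ := K.exists_toStrictModEl p
    subst hd
    exact ⟨b, (homX_eq_iff _ _ _).2 (by rw [hb, hp])⟩
  · intro h
    refine Set.eq_univ_of_forall fun p => ?_
    obtain ⟨a, ha⟩ := L.exists_toStrictModEl p
    obtain ⟨b, hb⟩ := h _ a
    exact ⟨K.toStrictModEl b, by rw [app_toStrictModEl, hb, ha]⟩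

end Components

/-! ### Free modules: generation, projectivity, and a criterion for exactness -/

section Free

variable {S : Type u} [Monoid S] [IsInverseSemigroup S] {T : IdemSet S}

/-- The basis element `(s, t)` is obtained from `(e, t)` by the action of `s`. -/
theorem FreeBasis.act_freeBasisι {e : Idem S} (b : FreeBasis T e)
    (h : conj b.s (T.deg b.t) = e) : FreeBasis.act b.s h (freeBasisι T b.t) = b :=
  FreeBasis.ext b.s_mul_deg rfl

theorem FreeBasis.conj_deg {e : Idem S} (b : FreeBasis T e) : conj b.s (T.deg b.t) = e :=
  (conj_eq_rIdem b.s_mul_deg).trans b.target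

theorem freeComponents_act_of (s : S) {e f : Idem S} (h : conj s e = f) (b : FreeBasis T e) :
    (freeComponents T).act s h (FreeAbelianGroup.of b) =
      FreeAbelianGroup.of (FreeBasis.act s h b) :=
  FreeAbelianGroup.map_of_apply b

/-- Since `s⁻¹ s` lies below the index of `t`, multiplying `s` by that index changes nothing. Hence
`(s, t)` is the translate by `s` of a generator, and morphisms are determined on generators. -/
theorem toStrictModEl_of {e : Idem S} (b : FreeBasis T e) :
    (freeComponents T).toStrictModEl (FreeAbelianGroup.of b) =
      (freeMod T).lam b.s (freeι T b.t) := by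
  refine Eq.trans ?_ (Components.lam_toStrictModEl (freeComponents T) b.s b.conj_deg _).symm
  rw [freeComponents_act_of, b.act_freeBasisι]

/-- The free module is generated by the image of `freeι` under the operations of an inverse
monoid and of `S`. -/
theorem freeMod_induction {p : freeMod T → Prop} (hι : ∀ s t, p ((freeMod T).lam s (freeι T t)))
    (hα : ∀ e, p ((freeMod T).alpha e)) (hmul : ∀ a b, p a → p b → p (a * b))
    (hinv : ∀ a, p a → p (sinv a)) (a : freeMod T) : p a := by
  obtain ⟨e, a⟩ := a
  change p ((freeComponents T).toStrictModEl a)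
  refine FreeAbelianGroup.induction_on
    (motive := fun a : FreeAbelianGroup (FreeBasis T e) => p ((freeComponents T).toStrictModEl a)) a
    (hα e) (fun b => ?_) (fun b hb => ?_) (fun a b ha hb => ?_)
  · rw [toStrictModEl_of]
    exact hι _ _
  · exact (Components.toStrictModEl_neg (freeComponents T) (FreeAbelianGroup.of b)) ▸ hinv _ hb
  · exact (Components.toStrictModEl_add (freeComponents T) a b) ▸ hmul _ _ ha hb

theorem freeMod_hom_ext {M : StrictMod S} {f g : freeMod T ⟶ M}
    (h : ∀ t, Hom.app f (freeι T t) = Hom.app g (freeι T t)) : f = g := by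
  refine hom_ext fun a => ?_
  induction a using freeMod_induction with
  | hι s t => rw [Hom.app_lam, Hom.app_lam, h]
  | hα e => rw [Hom.app_alpha, Hom.app_alpha]
  | hmul a b ha hb => rw [map_mul, map_mul, ha, hb]
  | hinv a ha => rw [map_sinv, map_sinv, ha]

/-- Preimages of the images of the generators can be chosen freely: morphisms preserve degrees, so
each chosen preimage automatically lies in the component that `freeLift` requires. -/
instance : Projective (freeMod T) where
  factors {E X} f e _ := by
    choose c hc using fun t => surjective_of_epi e (Hom.app f (freeι T t))
    have hd : ∀ t, E.deg (c t) = T.deg t := fun t => by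
      rw [← deg_app e, hc, deg_app, deg_freeι]
    exact ⟨freeLift c hd, freeMod_hom_ext fun t => by
      rw [Hom.app_comp, freeLift_ι, hc]⟩

/-- The `E(S)`-set underlying a strict inverse module. -/
def StrictMod.toIdemSet (A : StrictMod S) : IdemSet S := ⟨A, A.deg⟩

/-- The canonical morphism from the free module over the set underlying `A` to `A`. -/
def StrictMod.freeCover (A : StrictMod S) : freeMod A.toIdemSet ⟶ A :=
  freeLift (T := A.toIdemSet) (fun a : A => a) fun _ => rfl

theorem StrictMod.app_freeCover (A : StrictMod S) (a : A) :
    Hom.app A.freeCover (freeι A.toIdemSet a) = a :=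
  freeLift_ι (T := A.toIdemSet) (fun a : A => a) (fun _ => rfl) a

instance (A : StrictMod S) : Epi A.freeCover :=
  epi_of_surjective _ fun a => ⟨freeι A.toIdemSet a, A.app_freeCover a⟩

/-- A sequence of strict inverse modules in which every cycle is a boundary is exact. -/
theorem StrictMod.exact_of_kernel_subset {X Y Z : StrictMod S} (f : X ⟶ Y) (g : Y ⟶ Z)
    (w : f ≫ g = 0) (h : Hom.kernel g ⊆ Hom.image f) : (ShortComplex.mk f g w).Exact := by
  -- Preimages chosen elementwise need not form a morphism out of `A`, but they do define one out of
  -- the free module on the set `A`. Exactness up to refinements permits precomposing with the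
  -- epimorphism `A.freeCover`.
  rw [ShortComplex.exact_iff_exact_up_to_refinements]
  intro A x hx
  change A ⟶ Y at x
  change x ≫ g = 0 at hx
  have hk : ∀ a : A, Hom.app x a ∈ Hom.kernel g := fun a =>
    ⟨A.deg a, congrArg (fun k => Hom.app k a) hx⟩
  choose c hc using fun a => h (hk a)
  have hd : ∀ a, X.deg (c a) = A.deg a := fun a => by
    rw [← deg_app f, hc, deg_app]
  refine ⟨freeMod A.toIdemSet, A.freeCover, inferInstance,
    freeLift (T := A.toIdemSet) (fun a : A => c a) hd, ?_⟩
  refine freeMod_hom_ext fun a => ?_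
  have h1 := freeLift_ι (T := A.toIdemSet) (fun a : A => c a) hd a
  have h2 := A.app_freeCover a
  change Hom.app x (Hom.app A.freeCover _) = Hom.app f (Hom.app _ _)
  rw [h1, h2]
  exact (hc a).symm

end Free

/-! ### The grading of `S` by `G` -/

section Grading

variable {G : Type u} [Group G]

/-- Generating pairs have second entries that differ by an idempotent factor, and an idempotent maps
to the identity of a group. As the degree is multiplicative, the invariance passes to the generated
congruence. -/
theorem SModule.toGroup_eq_of_symRel {A : Type*} [CommMonoid A] (N : SModule (ExelMonoid G) A)
    {p q : N.Sym} (h : ConGen.Rel N.symRel p q) :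
    ExelMonoid.toGroup p.s = ExelMonoid.toGroup q.s := by
  induction h with
  | of p q h =>
    obtain ⟨-, e, he⟩ := h
    have h1 := congrArg ExelMonoid.toGroup e.2
    rw [map_mul, mul_eq_left] at h1
    rw [he, map_mul, h1, one_mul]
  | refl p => rfl
  | symm _ ih => exact ih.symm
  | trans _ _ ih₁ ih₂ => exact ih₁.trans ih₂
  | mul _ _ ih₁ ih₂ => rw [Sym.mul_s, Sym.mul_s, map_mul, map_mul, ih₁, ih₂]

/-- If `(A, π : S(G) → S)` is standard, then the natural map `S(G) → G` factors through `π`. -/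
theorem EpiStrictMod.IsStandard.exists_grading {M : EpiStrictMod (ExelMonoid G)}
    (hM : M.IsStandard) : ∃ σ : M.img.S →* G, ∀ t, σ (M.img.π t) = ExelMonoid.toGroup t := by
  obtain ⟨B, _, N, -, -, ψ, -, hψ, -⟩ := hM
  -- `ψ ∘ π` is the canonical map to the semidirect product, so elements identified by `π` are
  -- already identified there, where the degree is well defined.
  have key : ∀ t u, M.img.π t = M.img.π u → ExelMonoid.toGroup t = ExelMonoid.toGroup u := by
    intro t u h
    have h1 : N.toSemidirect t = N.toSemidirect u := by rw [← hψ, ← hψ, h]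
    exact N.toGroup_eq_of_symRel ((Con.eq _).1 h1)
  -- Any set-theoretic section of `π` will do: by `key` the degree of a preimage does not depend on
  -- the choice, which also gives multiplicativity.
  let c := Function.surjInv M.img.surjective
  have hc : ∀ s, M.img.π (c s) = s := Function.surjInv_eq M.img.surjective
  exact ⟨⟨⟨fun s => ExelMonoid.toGroup (c s),
      (key _ 1 (by rw [hc, map_one])).trans (map_one _)⟩,
    fun s t => (key _ (c s * c t) (by rw [map_mul, hc, hc, hc])).trans (map_mul _ _ _)⟩,
    fun t => key _ _ (hc _)⟩

theorem grading_idem {S : Type u} [Monoid S] (σ : S →* G) (e : Idem S) : σ e = 1 := by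
  have h1 := congrArg σ e.2
  rwa [map_mul, mul_eq_left] at h1

theorem grading_Gam {S : Type u} [Monoid S] {π : ExelMonoid G →* S} {σ : S →* G} (hσ : ∀ t, σ (π t) = ExelMonoid.toGroup t) (x : G) : σ (Gam π x) = x :=
  hσ _

/-- The normal form `p [x]` in `S(G)`, with `p` a product of idempotents `ε_y`, gives `s = f Γ(x)`
with `f` idempotent and `x = σ(s)`. Then `s s⁻¹ = f Γ(x) Γ(x)⁻¹`, and multiplying by `Γ(x)` returns
`s`. The contracting homotopy rests on this identity. -/
theorem rIdem_mul_Gam {S : Type u} [Monoid S] [IsInverseSemigroup S] {π : ExelMonoid G →* S}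
    {σ : S →* G} (hπ : Function.Surjective π)
    (hσ : ∀ t, σ (π t) = ExelMonoid.toGroup t) (s : S) : (rIdem s : S) * Gam π (σ s) = s := by
  obtain ⟨t, rfl⟩ := hπ s
  rw [hσ]
  obtain ⟨p, hp, ht⟩ := ExelMonoid.exists_normal t
  generalize ExelMonoid.toGroup t = x at ht
  subst ht
  let f : Idem S := ⟨π p, by rw [← map_mul, ExelMonoid.epsSub_idem hp]⟩
  have h : π (p * ExelMonoid.gen x) = (f : S) * Gam π x := map_mul _ _ _
  have hc := IdemComm.comm _ _ f.2 (mul_sinv_idem (Gam π x))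
  rw [h, coe_rIdem, sinv_mul, sinv_idem f.2]
  calc (f : S) * Gam π x * (sinv (Gam π x) * f) * Gam π x
      = f * ((Gam π x * sinv (Gam π x)) * f) * Gam π x := by simp only [mul_assoc]
    _ = (f * f) * (Gam π x * sinv (Gam π x) * Gam π x) := by
      rw [← hc]; simp only [mul_assoc]
    _ = f * Gam π x := by rw [f.2, mul_sinv_mul]

end Grading

/-! ### The boundary maps on basis elements -/

section Boundary

variable {G : Type u} [Group G] {S : Type u} [Monoid S] [IsInverseSemigroup S]
  (π : ExelMonoid G →* S)

/-- The components of `∂_{n+1} : R_{n+1} → R_n`. -/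
def bdryX (n : ℕ) (e : Idem S) :
    FreeAbelianGroup (FreeBasis (V π (n + 1)) e) →+ FreeAbelianGroup (FreeBasis (V π n) e) :=
  Components.homX (bdry π n) e

/-- The components of `∂_0 : R_0 → Z_S`. -/
def bdryZeroX (e : Idem S) : FreeAbelianGroup (FreeBasis (V π 0) e) →+ ULift.{u} ℤ :=
  Components.homX (L := trivialComponents S) (bdryZero π) e

theorem bdryX_act {n : ℕ} (s : S) {e f : Idem S} (h : conj s e = f)
    (a : FreeAbelianGroup (FreeBasis (V π (n + 1)) e)) :
    bdryX π n f (FreeAbelianGroup.map (FreeBasis.act s h) a) =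
      FreeAbelianGroup.map (FreeBasis.act s h) (bdryX π n e a) :=
  Components.homX_act (K := freeComponents (V π (n + 1))) (L := freeComponents (V π n))
    (bdry π n) s h a

theorem bdryX_of_freeBasisι {n : ℕ} (x : Fin (n + 1) → G) :
    bdryX π n (epsTuple π x) (FreeAbelianGroup.of (freeBasisι (V π (n + 1)) x)) =
      bdryValue π x :=
  (Components.homX_eq_iff (K := freeComponents (V π (n + 1))) (L := freeComponents (V π n))
    (bdry π n) _ _).2 (freeLift_ι _ _ _)

theorem map_act_bdryValue {n : ℕ} (s : S) {e : Idem S} (x : Fin (n + 1) → G)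
    (h : conj s (epsTuple π x) = e) :
    FreeAbelianGroup.map (FreeBasis.act s h) (bdryValue π x) =
      FreeAbelianGroup.of (FreeBasis.act s h (bdryFirst π x)) + ∑ j : Fin (n + 1),
        ((-1 : ℤ) ^ ((j : ℕ) + 1)) •
          FreeAbelianGroup.of (FreeBasis.act s h (bdryContract π x j)) := by
  change FreeAbelianGroup.map _ (_ + ∑ j : Fin (n + 1), _) = _
  rw [map_add, map_sum, FreeAbelianGroup.map_of_apply]
  simp only [map_zsmul, FreeAbelianGroup.map_of_apply]

variable {π} in
/-- The tuple of a basis element of `R_n`. -/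
def FreeBasis.tuple {n : ℕ} {e : Idem S} (b : FreeBasis (V π n) e) : Fin n → G := b.t

variable {π} in
theorem FreeBasis.conj_tuple {n : ℕ} {e : Idem S} (b : FreeBasis (V π n) e) :
    conj b.s (epsTuple π b.tuple) = e := b.conj_deg

/-- `∂` is prescribed on generators only; writing `b` as the translate of a generator by `b.s`,
equivariance carries the formula to all basis elements. -/
theorem bdryX_of {n : ℕ} {e : Idem S} (b : FreeBasis (V π (n + 1)) e) :
    bdryX π n e (FreeAbelianGroup.of b) =
      FreeAbelianGroup.of (FreeBasis.act b.s b.conj_tuple (bdryFirst π b.tuple)) +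
        ∑ j : Fin (n + 1), ((-1 : ℤ) ^ ((j : ℕ) + 1)) •
          FreeAbelianGroup.of (FreeBasis.act b.s b.conj_tuple (bdryContract π b.tuple j)) := by
  conv_lhs => rw [← b.act_freeBasisι b.conj_deg, ← FreeAbelianGroup.map_of_apply, bdryX_act]
  exact (congrArg _ (bdryX_of_freeBasisι π b.tuple)).trans (map_act_bdryValue π _ _ _)

/-- The action of `S` on `Z_S` moves the index and leaves the integer unchanged, so every translate
of the generator still has augmentation `1`. -/
theorem bdryZeroX_of {e : Idem S} (b : FreeBasis (V π 0) e) :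
    bdryZeroX π e (FreeAbelianGroup.of b) = ULift.up 1 := by
  refine (Components.homX_eq_iff (K := freeComponents (V π 0)) (L := trivialComponents S)
    (bdryZero π) _ _).2 ?_
  rw [toStrictModEl_of]
  refine (Hom.app_lam (bdryZero π) _ _).trans ?_
  refine (congrArg _ (freeLift_ι (T := V π 0) _ _ b.t)).trans ?_
  refine Components.lam_toStrictModEl (trivialComponents S) b.s ?_ _
  exact b.conj_deg

end Boundary

/-! ### The contracting homotopy -/

section Contraction

variable {G : Type u} [Group G] {S : Type u} [Monoid S] [IsInverseSemigroup S]
  (π : ExelMonoid G →* S) (σ : S →* G)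

/-- The map `(s, (x₁,…,xₙ)) ↦ (s s⁻¹, (σ(s), x₁,…,xₙ))`. -/
def consBasis (hπ : Function.Surjective π) (hσ : ∀ t, σ (π t) = ExelMonoid.toGroup t) {n : ℕ}
    {e : Idem S} (b : FreeBasis (V π n) e) : FreeBasis (V π (n + 1)) e where
  s := e
  t := Fin.cons (σ b.s) b.t
  target := rIdem_idem e
  source := by
    rw [sinv_idem e.2, e.2]
    -- The new tuple `(σ(s), x)` must lie in a component whose index is above `e`. Its index is
    -- `ε_x` conjugated by `Γ(σ(s))`; multiplying by `e` turns this into conjugation by `e Γ(σ(s)) =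
    -- s`, and `s ε_x s⁻¹ = e`.
    have h1 : epsTuple π (Fin.cons (σ b.s) b.t : Fin (n + 1) → G) =
        conj (Gam π (σ b.s)) (epsTuple π b.t) := by
      rw [← conj_epsTuple]
      rfl
    have h2 : e * epsTuple π (Fin.cons (σ b.s) b.t : Fin (n + 1) → G) = e := by
      rw [h1, ← conj_idem, ← conj_mul]
      have h3 : (e : S) * Gam π (σ b.s) = b.s := by
        have h4 := rIdem_mul_Gam hπ hσ b.s
        rwa [b.target] at h4
      rw [h3]
      exact b.conj_deg
    exact congrArg Idem.val h2

variable {π σ}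

/-- The degree of `Γ(x₁) ε` is `x₁`, so the homotopy restores the entry that the leading face
removed. Hence every generator of `R_{n+1}` is in the image of the homotopy, as `R_hom_ext_of_contr`
needs. -/
theorem consBasis_bdryFirst (hπ : Function.Surjective π)
    (hσ : ∀ t, σ (π t) = ExelMonoid.toGroup t) {n : ℕ} (x : Fin (n + 1) → G) :
    consBasis π σ hπ hσ (bdryFirst π x) = freeBasisι (V π (n + 1)) x := by
  refine FreeBasis.ext rfl ?_
  change Fin.cons (σ (Gam π (x 0) * epsTuple π (Fin.tail x))) (Fin.tail x) = x
  rw [map_mul, grading_idem, mul_one, grading_Gam hσ, Fin.cons_self_tail]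

/-- The leading face of `h(b)` moves `Γ(σ(s))` back into the first coordinate, and `e Γ(σ(s)) = s`.
This is the identity term of the homotopy formula. -/
theorem act_bdryFirst_cons (hπ : Function.Surjective π)
    (hσ : ∀ t, σ (π t) = ExelMonoid.toGroup t) {n : ℕ} {e : Idem S} (b : FreeBasis (V π n) e) :
    FreeBasis.act (consBasis π σ hπ hσ b).s (consBasis π σ hπ hσ b).conj_tuple
      (bdryFirst π (consBasis π σ hπ hσ b).tuple) = b := by
  refine FreeBasis.ext ?_ rfl
  change (e : S) * (Gam π (σ b.s) * epsTuple π b.t) = b.s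
  have h3 : (e : S) * Gam π (σ b.s) = b.s := by
    have h4 := rIdem_mul_Gam hπ hσ b.s
    rwa [b.target] at h4
  rw [← mul_assoc, h3]
  exact b.s_mul_deg

/-- Faces beyond the first inner one do not touch the prepended entry. For the largest `j` both
sides drop the last entry. -/
theorem contractNth_cons_succ {n : ℕ} (g : G) (v : Fin (n + 1) → G) (j : Fin (n + 1)) :
    Fin.contractNth j.succ (· * ·) (Fin.cons g v : Fin (n + 2) → G) =
      (Fin.cons g (Fin.contractNth j (· * ·) v) : Fin (n + 1) → G) := by
  funext k
  refine Fin.cases ?_ (fun k => ?_) k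
  · rw [Fin.contractNth_apply_of_lt]
    · rfl
    · simp
  · rw [Fin.cons_succ]
    rcases lt_trichotomy (k : ℕ) j with h | h | h
    · rw [Fin.contractNth_apply_of_lt _ _ _ _ h, Fin.contractNth_apply_of_lt]
      · rfl
      · simpa using h
    · rw [Fin.contractNth_apply_of_eq _ _ _ _ h, Fin.contractNth_apply_of_eq]
      · rfl
      · simpa using h
    · rw [Fin.contractNth_apply_of_gt _ _ _ _ h, Fin.contractNth_apply_of_gt]
      · rfl
      · simpa using h

/-- The first inner face absorbs `v 0` into the prepended entry; for `g = σ(s)` this matches `σ(s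
Γ(v 0)) = σ(s) (v 0)`. -/
theorem contractNth_zero_cons {n : ℕ} (g : G) (v : Fin (n + 1) → G) :
    Fin.contractNth 0 (· * ·) (Fin.cons g v : Fin (n + 2) → G) =
      (Fin.cons (g * v 0) (Fin.tail v) : Fin (n + 1) → G) := by
  funext k
  refine Fin.cases ?_ (fun k => ?_) k
  · rw [Fin.contractNth_apply_of_eq]
    · rfl
    · simp
  · rw [Fin.contractNth_apply_of_gt]
    · rfl
    · simp

variable (hπ : Function.Surjective π) (hσ : ∀ t, σ (π t) = ExelMonoid.toGroup t)

/-- The contracting homotopy. -/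
def contr (n : ℕ) (e : Idem S) :
    FreeAbelianGroup (FreeBasis (V π n) e) →+ FreeAbelianGroup (FreeBasis (V π (n + 1)) e) :=
  FreeAbelianGroup.map (consBasis π σ hπ hσ)

theorem contr_of {n : ℕ} {e : Idem S} (b : FreeBasis (V π n) e) :
    contr hπ hσ n e (FreeAbelianGroup.of b) = FreeAbelianGroup.of (consBasis π σ hπ hσ b) :=
  FreeAbelianGroup.map_of_apply b

/-- On a basis element `b`, the leading face of `h(b)` is `b`. The contraction `0` of `h(b)` is `h`
of the leading face of `b`, and the contraction `j + 1` of `h(b)` is `h` of the contraction `j` of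
`b`; in each case the two occurrences have opposite signs. -/
theorem bdryX_contr_succ (n : ℕ) (e : Idem S)
    (a : FreeAbelianGroup (FreeBasis (V π (n + 1)) e)) :
    bdryX π (n + 1) e (contr hπ hσ (n + 1) e a) + contr hπ hσ n e (bdryX π n e a) = a := by
  have key : ((bdryX π (n + 1) e).comp (contr hπ hσ (n + 1) e) +
      (contr hπ hσ n e).comp (bdryX π n e)) = AddMonoidHom.id _ := by
    refine FreeAbelianGroup.lift_ext _ _ fun b => ?_
    change bdryX π (n + 1) e (contr hπ hσ (n + 1) e (FreeAbelianGroup.of b)) +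
      contr hπ hσ n e (bdryX π n e (FreeAbelianGroup.of b)) = FreeAbelianGroup.of b
    rw [contr_of, bdryX_of, bdryX_of, act_bdryFirst_cons,
      map_add, map_sum, contr_of, Fin.sum_univ_succ]
    simp only [map_zsmul, contr_of]
    -- Both first coordinates are `e`, so only the tuples have to be compared, here and in `hs`.
    have h0 : FreeBasis.act (consBasis π σ hπ hσ b).s (consBasis π σ hπ hσ b).conj_tuple
        (bdryContract π (consBasis π σ hπ hσ b).tuple 0) =
        consBasis π σ hπ hσ (FreeBasis.act b.s b.conj_tuple (bdryFirst π b.tuple)) := by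
      refine FreeBasis.ext ?_ ?_
      · exact (consBasis π σ hπ hσ b).s_mul_deg
      · change Fin.contractNth 0 (· * ·) (Fin.cons (σ b.s) b.tuple : Fin (n + 2) → G) =
          Fin.cons (σ (b.s * (Gam π (b.tuple 0) * epsTuple π (Fin.tail b.tuple))))
            (Fin.tail b.tuple)
        rw [contractNth_zero_cons, map_mul, map_mul, grading_idem, mul_one, grading_Gam hσ]
    -- The first coordinate of a translated contraction is `b.s` times an idempotent, so its degree
    -- is still `σ(b.s)`.
    have hs : ∀ j : Fin (n + 1),
        FreeBasis.act (consBasis π σ hπ hσ b).s (consBasis π σ hπ hσ b).conj_tuple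
          (bdryContract π (consBasis π σ hπ hσ b).tuple j.succ) =
        consBasis π σ hπ hσ (FreeBasis.act b.s b.conj_tuple (bdryContract π b.tuple j)) := by
      intro j
      refine FreeBasis.ext ?_ ?_
      · exact (consBasis π σ hπ hσ b).s_mul_deg
      · change Fin.contractNth j.succ (· * ·) (Fin.cons (σ b.s) b.tuple : Fin (n + 2) → G) =
          Fin.cons (σ (b.s * (epsTuple π b.tuple : S))) (Fin.contractNth j (· * ·) b.tuple)
        rw [contractNth_cons_succ, map_mul, grading_idem, mul_one]
    simp only [h0, hs, Fin.val_zero, Fin.val_succ, zero_add, pow_one, pow_succ _ (_ + 1),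
      mul_neg, mul_one, neg_smul, one_smul, Finset.sum_neg_distrib]
    abel
  exact DFunLike.congr_fun key a

/-- The augmentation's section `1_e ↦ (e, ())`. -/
def contrZero (π : ExelMonoid G →* S) (e : Idem S) :
    ULift.{u} ℤ →+ FreeAbelianGroup (FreeBasis (V π 0) e) :=
  (zmultiplesHom _ (FreeAbelianGroup.of
    (⟨e, Fin.elim0, rIdem_idem e, by
      change _ * ((1 : Idem S) : S) = _
      rw [Idem.coe_one, mul_one]⟩ :
        FreeBasis (V π 0) e))).comp AddEquiv.ulift.toAddMonoidHom

/-- Here `∂h(s, ()) = (s, ()) - (e, ())`, and the subtracted term is the section `contrZero` applied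
to the augmentation of `(s, ())`. -/
theorem bdryX_contr_zero (e : Idem S) (a : FreeAbelianGroup (FreeBasis (V π 0) e)) :
    bdryX π 0 e (contr hπ hσ 0 e a) + contrZero π e (bdryZeroX π e a) = a := by
  have key : ((bdryX π 0 e).comp (contr hπ hσ 0 e) +
      (contrZero π e).comp (bdryZeroX π e)) = AddMonoidHom.id _ := by
    refine FreeAbelianGroup.lift_ext _ _ fun b => ?_
    change bdryX π 0 e (contr hπ hσ 0 e (FreeAbelianGroup.of b)) +
      contrZero π e (bdryZeroX π e (FreeAbelianGroup.of b)) = FreeAbelianGroup.of b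
    rw [contr_of, bdryX_of, act_bdryFirst_cons, bdryZeroX_of,
      Fin.sum_univ_one]
    have h1 : contrZero π e (ULift.up 1) = FreeAbelianGroup.of
        (FreeBasis.act (consBasis π σ hπ hσ b).s (consBasis π σ hπ hσ b).conj_tuple
          (bdryContract π (consBasis π σ hπ hσ b).tuple 0)) := by
      refine (one_zsmul _).trans (congrArg FreeAbelianGroup.of (FreeBasis.ext ?_ ?_))
      · exact (consBasis π σ hπ hσ b).s_mul_deg.symm
      · exact Subsingleton.elim (α := Fin 0 → G) _ _
    rw [h1]
    simp
  exact DFunLike.congr_fun key a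

theorem bdryZeroX_contrZero (e : Idem S) (n : ULift.{u} ℤ) :
    bdryZeroX π e (contrZero π e n) = n := by
  obtain ⟨n⟩ := n
  have h : contrZero π e ⟨n⟩ = n • FreeAbelianGroup.of _ := rfl
  rw [h, map_zsmul, bdryZeroX_of]
  ext
  simp

end Contraction

/-! ### `∂∂ = 0` and exactness, from the homotopy -/

section Complex

variable {G : Type u} [Group G] {S : Type u} [Monoid S] [IsInverseSemigroup S]
  {π : ExelMonoid G →* S} {σ : S →* G}

/-- The element of `R_n` given by an element of a component. -/
def elR {n : ℕ} {e : Idem S} (a : FreeAbelianGroup (FreeBasis (V π n) e)) : R π n :=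
  (freeComponents (V π n)).toStrictModEl a

theorem elR_injective {n : ℕ} {e : Idem S} :
    Function.Injective (elR : FreeAbelianGroup (FreeBasis (V π n) e) → R π n) :=
  Components.toStrictModEl_injective (freeComponents (V π n))

theorem elR_zero {n : ℕ} (e : Idem S) :
    elR (0 : FreeAbelianGroup (FreeBasis (V π n) e)) = (R π n).alpha e := rfl

theorem app_zero_elR {M : StrictMod S} {n : ℕ} {e : Idem S}
    (a : FreeAbelianGroup (FreeBasis (V π n) e)) :
    Hom.app (0 : R π n ⟶ M) (elR a) = M.alpha e :=
  congrArg (fun i => (M.alpha i : M)) (Components.deg_toStrictModEl _)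

theorem app_bdry {n : ℕ} {e : Idem S} (a : FreeAbelianGroup (FreeBasis (V π (n + 1)) e)) :
    Hom.app (bdry π n) (elR a) = elR (bdryX π n e a) :=
  Components.app_toStrictModEl (bdry π n) a

theorem app_bdryZero {e : Idem S} (a : FreeAbelianGroup (FreeBasis (V π 0) e)) :
    Hom.app (bdryZero π) (elR a) =
      (trivialComponents S).toStrictModEl (e := e) (bdryZeroX π e a) :=
  Components.app_toStrictModEl (L := trivialComponents S) (bdryZero π) a

/-- Morphisms from `R_{n+1}` that agree on the image of the contracting homotopy are equal. -/
theorem R_hom_ext_of_contr (hπ : Function.Surjective π)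
    (hσ : ∀ t, σ (π t) = ExelMonoid.toGroup t) {n : ℕ} {M : StrictMod S} {f g : R π (n + 1) ⟶ M}
    (h : ∀ (e : Idem S) (a : FreeAbelianGroup (FreeBasis (V π n) e)),
      Hom.app f (elR (contr hπ hσ n e a)) = Hom.app g (elR (contr hπ hσ n e a))) :
    f = g := by
  refine freeMod_hom_ext fun (x : Fin (n + 1) → G) => ?_
  -- The generator `x` is the value of the homotopy at the leading term of `∂x`.
  have h1 := h _ (FreeAbelianGroup.of (bdryFirst π x))
  rw [contr_of, consBasis_bdryFirst] at h1
  exact h1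

theorem bdryX_bdryX_of_comp {n : ℕ} (w : bdry π (n + 1) ≫ bdry π n = 0) (e : Idem S)
    (a : FreeAbelianGroup (FreeBasis (V π (n + 2)) e)) :
    bdryX π n e (bdryX π (n + 1) e a) = 0 := by
  apply elR_injective
  have h : Hom.app (bdry π n) (Hom.app (bdry π (n + 1)) (elR a)) =
      Hom.app (0 : R π (n + 2) ⟶ R π n) (elR a) := congrArg (fun k => Hom.app k (elR a)) w
  rwa [app_bdry, app_bdry, app_zero_elR] at h

/-- Applying `∂₀` to `∂₁h + η∂₀ = id`, where `η` is the section of `∂₀`, gives `∂₀∂₁h = 0`; this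
suffices because the image of `h` generates `R₁`. -/
theorem bdry_comp_bdryZero (hπ : Function.Surjective π)
    (hσ : ∀ t, σ (π t) = ExelMonoid.toGroup t) : bdry π 0 ≫ bdryZero π = 0 := by
  refine R_hom_ext_of_contr hπ hσ fun e a => ?_
  have h1 := congrArg (bdryZeroX π e) (bdryX_contr_zero hπ hσ e a)
  rw [map_add, bdryZeroX_contrZero, add_eq_right] at h1
  change Hom.app (bdryZero π) (Hom.app (bdry π 0) _) = _
  rw [app_bdry, app_bdryZero, h1, app_zero_elR]
  rfl

theorem bdryZeroX_bdryX (hπ : Function.Surjective π)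
    (hσ : ∀ t, σ (π t) = ExelMonoid.toGroup t) (e : Idem S)
    (a : FreeAbelianGroup (FreeBasis (V π 1) e)) :
    bdryZeroX π e (bdryX π 0 e a) = 0 := by
  apply Components.toStrictModEl_injective (trivialComponents S) (e := e)
  have h : Hom.app (bdryZero π) (Hom.app (bdry π 0) (elR a)) =
      Hom.app (0 : R π 1 ⟶ trivialMod S) (elR a) :=
    congrArg (fun k => Hom.app k (elR a)) (bdry_comp_bdryZero hπ hσ)
  rwa [app_bdry, app_bdryZero, app_zero_elR] at h

/-- Using the homotopy identity twice, `∂∂h = ∂(1 - h∂) = ∂ - (1 - h∂)∂ = h∂∂`, and the last `∂∂` is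
one degree lower, so it vanishes by induction. Vanishing on the image of `h` is enough, since that
image generates. -/
theorem bdry_comp_bdry (hπ : Function.Surjective π)
    (hσ : ∀ t, σ (π t) = ExelMonoid.toGroup t) (n : ℕ) : bdry π (n + 1) ≫ bdry π n = 0 := by
  have key : ∀ n, (∀ (e : Idem S) (a : FreeAbelianGroup (FreeBasis (V π (n + 1)) e)),
      bdryX π n e (bdryX π (n + 1) e (contr hπ hσ (n + 1) e a)) = 0) →
      bdry π (n + 1) ≫ bdry π n = 0 := by
    intro n h
    refine R_hom_ext_of_contr hπ hσ fun e a => ?_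
    change Hom.app (bdry π n) (Hom.app (bdry π (n + 1)) _) = _
    rw [app_bdry, app_bdry, h, app_zero_elR, elR_zero]
  induction n with
  | zero =>
    refine key 0 fun e a => ?_
    have h1 := congrArg (bdryX π 0 e) (bdryX_contr_succ hπ hσ 0 e a)
    -- In the lowest degree the augmented complex plays the role of the induction hypothesis: the
    -- correction term contains `∂₀∂₁ = 0`.
    have h2 := bdryX_contr_zero hπ hσ e (bdryX π 0 e a)
    rw [bdryZeroX_bdryX hπ hσ, map_zero, add_zero] at h2
    rwa [map_add, h2, add_eq_right] at h1
  | succ n ih =>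
    refine key (n + 1) fun e a => ?_
    have h1 := congrArg (bdryX π (n + 1) e) (bdryX_contr_succ hπ hσ (n + 1) e a)
    have h2 := bdryX_contr_succ hπ hσ n e (bdryX π (n + 1) e a)
    rw [bdryX_bdryX_of_comp ih, map_zero, add_zero] at h2
    rwa [map_add, h2, add_eq_right] at h1

/-- On a cycle the homotopy identity reads `∂h(a) = a`. -/
theorem kernel_bdry (hπ : Function.Surjective π)
    (hσ : ∀ t, σ (π t) = ExelMonoid.toGroup t) (n : ℕ) :
    Hom.kernel (bdry π n) = Hom.image (bdry π (n + 1)) := by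
  refine (Components.kernel_eq_image_iff (bdry π (n + 1)) (bdry π n)).2 fun e a => ⟨fun h => ?_, ?_⟩
  · have h1 := bdryX_contr_succ hπ hσ n e a
    rw [show bdryX π n e a = 0 from h, map_zero, add_zero] at h1
    exact ⟨_, h1⟩
  · rintro ⟨b, rfl⟩
    exact bdryX_bdryX_of_comp (bdry_comp_bdry hπ hσ n) e b

theorem kernel_bdryZero (hπ : Function.Surjective π)
    (hσ : ∀ t, σ (π t) = ExelMonoid.toGroup t) :
    Hom.kernel (bdryZero π) = Hom.image (bdry π 0) := by
  refine (Components.kernel_eq_image_iff (N := trivialComponents S) (bdry π 0)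
    (bdryZero π)).2 fun e a => ⟨fun h => ?_, ?_⟩
  · have h1 := bdryX_contr_zero hπ hσ e a
    rw [show bdryZeroX π e a = 0 from h, map_zero, add_zero] at h1
    exact ⟨_, h1⟩
  · rintro ⟨b, rfl⟩
    exact bdryZeroX_bdryX hπ hσ e b

theorem image_bdryZero (π : ExelMonoid G →* S) : Hom.image (bdryZero π) = Set.univ :=
  (Components.image_eq_univ_iff (L := trivialComponents S) (bdryZero π)).2 fun e n =>
    ⟨contrZero π e n, bdryZeroX_contrZero e n⟩

end Complex

/-! ### Comparing cohomology groups of sequences -/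

section SeqCohomology

/-- A surjective homomorphism from the cocycles whose kernel consists of the coboundaries
identifies the cohomology group with its target. -/
theorem nonempty_seqCohomology_addEquiv {C : ℕ → Type*} [∀ n, AddCommGroup (C n)]
    (d : ∀ n, C n →+ C (n + 1)) {n : ℕ} {X : Type*} [AddCommGroup X] (g : (d n).ker →+ X)
    (hg : Function.Surjective g) (hker : ∀ c, g c = 0 ↔ (c : C n) ∈ seqCoboundaries d n) :
    Nonempty (SeqCohomology d n ≃+ X) := by
  have h : (seqCoboundaries d n).addSubgroupOf (d n).ker = g.ker := by
    ext c
    rw [AddSubgroup.mem_addSubgroupOf, AddMonoidHom.mem_ker, hker]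
  exact ⟨(QuotientAddGroup.quotientAddEquivOfEq h).trans
    (QuotientAddGroup.quotientKerEquivOfSurjective g hg)⟩

/-- Isomorphic sequences of homomorphisms have isomorphic cohomology groups. -/
theorem nonempty_seqCohomology_congr {C D : ℕ → Type*} [∀ n, AddCommGroup (C n)]
    [∀ n, AddCommGroup (D n)] (d : ∀ n, C n →+ C (n + 1)) (d' : ∀ n, D n →+ D (n + 1))
    (Φ : ∀ n, C n ≃+ D n) (h : ∀ n c, Φ (n + 1) (d n c) = d' n (Φ n c)) (n : ℕ) :
    Nonempty (SeqCohomology d n ≃+ SeqCohomology d' n) := by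
  have hmem : ∀ c : (d n).ker, Φ n c ∈ (d' n).ker := fun c => by
    rw [AddMonoidHom.mem_ker, ← h, show d n c = 0 from c.2, map_zero]
  -- Degree `0` is separate: the coboundaries there are trivial by convention, so injectivity of `Φ
  -- 0` replaces compatibility with the differentials.
  have hb : ∀ n c, Φ n c ∈ seqCoboundaries d' n ↔ c ∈ seqCoboundaries d n := by
    intro n c
    cases n with
    | zero =>
      change Φ 0 c ∈ (⊥ : AddSubgroup _) ↔ c ∈ (⊥ : AddSubgroup _)
      rw [AddSubgroup.mem_bot, AddSubgroup.mem_bot, map_eq_zero_iff _ (Φ 0).injective]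
    | succ n =>
      constructor
      · rintro ⟨b, hb⟩
        refine ⟨(Φ n).symm b, (Φ (n + 1)).injective ?_⟩
        rw [h, AddEquiv.apply_symm_apply, hb]
      · rintro ⟨b, rfl⟩
        exact ⟨Φ n b, (h n b).symm⟩
  let k : (d n).ker →+ (d' n).ker :=
    ((Φ n).toAddMonoidHom.comp (d n).ker.subtype).codRestrict (d' n).ker hmem
  refine nonempty_seqCohomology_addEquiv d ((QuotientAddGroup.mk' _).comp k) ?_ ?_
  · intro y
    obtain ⟨c, rfl⟩ := QuotientAddGroup.mk'_surjective _ y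
    have hc : (Φ n).symm c ∈ (d n).ker := by
      rw [AddMonoidHom.mem_ker]
      apply (Φ (n + 1)).injective
      rw [h, AddEquiv.apply_symm_apply, map_zero]
      exact c.2
    have hk : k ⟨_, hc⟩ = c := Subtype.ext ((Φ n).apply_symm_apply c)
    exact ⟨⟨_, hc⟩, congrArg (QuotientAddGroup.mk' _) hk⟩
  · intro c
    rw [AddMonoidHom.comp_apply, ← AddMonoidHom.mem_ker, QuotientAddGroup.ker_mk',
      AddSubgroup.mem_addSubgroupOf, ← hb]
    rfl

end SeqCohomology

/-! ### `Hom(R_•, A)` as the complex of partial cochains -/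

section Cochains

variable {G : Type u} [Group G] {S : Type u} [Monoid S] [IsInverseSemigroup S]
  {π : ExelMonoid G →* S} {A : StrictMod S} {P : PartialModule G A}

theorem alpha_epsTuple (hα : ∀ x, A.alpha (epsS π x) = P.idem x) {n : ℕ} (x : Fin n → G) :
    A.alpha (epsTuple π x) = P.cochainIdem x := by
  unfold epsTuple PartialModule.cochainIdem tupleIdem
  rw [map_prod]
  exact Finset.prod_congr rfl fun i _ => hα _

theorem deg_app_freeι {T : IdemSet S} (f : freeMod T ⟶ A) (t : T.X) :
    A.deg (Hom.app f (freeι T t)) = T.deg t := by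
  rw [deg_app, deg_freeι]

theorem lam_deg_app_freeι {T : IdemSet S} (f : freeMod T ⟶ A) (t : T.X) :
    A.lam (T.deg t) (Hom.app f (freeι T t)) = Hom.app f (freeι T t) := by
  rw [A.str.lam_idem, ← deg_app_freeι f t, A.alpha_deg_mul]

/-- Restriction to `V_n` is an isomorphism from `Hom(R_n, A)` to `Cⁿ(G, A)`. -/
def cochainEquiv (hα : ∀ x, A.alpha (epsS π x) = P.idem x) (n : ℕ) :
    (R π n ⟶ A) ≃+ Additive (P.Cochain n) where
  toFun f := Additive.ofMul fun x => toUnit (Hom.app f (freeι (V π n) x)) (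
    (A.alpha_deg _).symm.trans ((congrArg A.alpha (deg_app_freeι (T := V π n) f x)).trans
      (alpha_epsTuple hα x)))
  -- Being invertible in the ideal with identity `1_{x₁} ⋯ 1_{x₁⋯xₙ} = α(ε_x)` means having degree
  -- `ε_x`, which is the condition for extending to the free module.
  invFun c := freeLift (T := V π n) (fun x => uval (Additive.toMul c x)) fun x => by
    rw [deg_eq_iff, rIdem_uval]
    exact (alpha_epsTuple hα x).symm
  left_inv f := freeMod_hom_ext fun x => freeLift_ι _ _ _
  right_inv c := by
    apply Additive.toMul.injective
    funext x
    apply uval_injective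
    exact freeLift_ι (T := V π n) _ _ _
  map_add' f g := by
    apply Additive.toMul.injective
    funext x
    apply uval_injective
    rfl

theorem app_elR_of {n : ℕ} {e : Idem S} (f : R π n ⟶ A) (b : FreeBasis (V π n) e) :
    Hom.app f (elR (FreeAbelianGroup.of b)) = A.lam b.s (Hom.app f (freeι (V π n) b.t)) :=
  (congrArg (Hom.app f) (toStrictModEl_of b)).trans (Hom.app_lam f _ _)

/-- On the component of index `ε_x`, `f` is a group homomorphism into the units of the ideal of `x`,
so it turns the signed sum `∂x` into a product with exponents `±1`. Its leading factor comes from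
`λ_{Γ(x₁)}`, which is the partial action; the others come from `λ_{ε_x}`, which is multiplication by
the identity of the ideal. -/
theorem cochainEquiv_coboundary (hα : ∀ x, A.alpha (epsS π x) = P.idem x)
    (hlam : ∀ x a, A.lam (Gam π x) a = P.act x a) (n : ℕ) (f : R π n ⟶ A) :
    cochainEquiv hα (n + 1) (homCoboundary π A n f) =
      MonoidHom.toAdditive (P.coboundary n) (cochainEquiv hα n f) := by
  apply Additive.toMul.injective
  funext x
  -- the homomorphism from the component of `R_n` to the units of the ideal of `x`
  have he : MulHom.id A (A.alpha (epsTuple π x)) = P.cochainIdem x :=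
    congrArg Idem.val (alpha_epsTuple hα x)
  let η : FreeAbelianGroup (FreeBasis (V π n) (epsTuple π x)) →+
      Additive (unitalIdeal (P.cochainIdem x))ˣ :=
    (MonoidHom.toAdditive (Units.map (idealMap (MulHom.id A) he))).comp
      (Components.homUnits (freeComponents (V π n)) f (epsTuple π x))
  have hη : ∀ a, uval (Additive.toMul (η a)) = Hom.app f (elR a) := fun a => rfl
  have h1 : Additive.toMul (cochainEquiv hα (n + 1) (homCoboundary π A n f)) x =
      Additive.toMul (η (bdryValue π x)) := by
    apply uval_injective
    refine Eq.trans ?_ (hη _).symm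
    change Hom.app f (Hom.app (bdry π n) (freeι (V π (n + 1)) x)) = _
    exact congrArg (Hom.app f) (freeLift_ι _ _ _)
  have hfirst : Additive.toMul (η (FreeAbelianGroup.of (bdryFirst π x))) =
      Units.map (idealMap (P.act (x 0)) (P.act_cochainIdem x))
        (Additive.toMul (cochainEquiv hα n f) (Fin.tail x)) := by
    apply uval_injective
    rw [hη, app_elR_of]
    change A.lam (Gam π (x 0) * epsTuple π (Fin.tail x)) (Hom.app f (freeι (V π n) (Fin.tail x))) =
      P.act (x 0) (Hom.app f (freeι (V π n) (Fin.tail x)))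
    -- The factor `ε_{(x₂,…)}` of the leading term acts trivially, because the value of `f` at the
    -- tail already lies in that component.
    rw [A.str.lam_mul, ← hlam]
    exact congrArg _ (lam_deg_app_freeι (T := V π n) f (Fin.tail x))
  have hcontract : ∀ j, Additive.toMul (η (FreeAbelianGroup.of (bdryContract π x j))) =
      Units.map (idealMap (mulIdem (P.cochainIdem x)) (P.mulIdem_cochainIdem x j))
        (Additive.toMul (cochainEquiv hα n f) (Fin.contractNth j (· * ·) x)) := by
    intro j
    apply uval_injective
    rw [hη, app_elR_of]
    change A.lam (epsTuple π x) _ = (P.cochainIdem x : A) * _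
    rw [A.str.lam_idem, alpha_epsTuple hα]
    rfl
  rw [h1]
  have h2 : η (bdryValue π x) = η (FreeAbelianGroup.of (bdryFirst π x)) + ∑ j : Fin (n + 1),
      ((-1 : ℤ) ^ ((j : ℕ) + 1)) • η (FreeAbelianGroup.of (bdryContract π x j)) := by
    refine (map_add η _ _).trans (congrArg _ ((map_sum η _ _).trans ?_))
    exact Finset.sum_congr rfl fun j _ => map_zsmul η _ _
  rw [h2, toMul_add, hfirst, toMul_sum]
  simp only [toMul_zsmul, hcontract]
  rfl

end Cochains

/-! ### `Ext` from a projective resolution -/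

section Ext

universe v w

variable {C : Type u} [Category.{v} C] [Abelian C]

/-- The projective resolution given by an exact sequence `⋯ → X_1 → X_0 → Z → 0` of projective
objects. -/
def projectiveResolutionOfExact (X : ℕ → C) [∀ n, Projective (X n)] (d : ∀ n, X (n + 1) ⟶ X n)
    {Z : C} (ε : X 0 ⟶ Z) [Epi ε] (hd : ∀ n, d (n + 1) ≫ d n = 0) (hε : d 0 ≫ ε = 0)
    (ed : ∀ n, (ShortComplex.mk _ _ (hd n)).Exact) (eε : (ShortComplex.mk _ _ hε).Exact) :
    ProjectiveResolution Z where
  complex := ChainComplex.of X d hd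
  projective n := inferInstanceAs (Projective (X n))
  π := (ChainComplex.toSingle₀Equiv _ _).symm ⟨ε, by
    have h : (ChainComplex.of X d hd).d 1 0 = d 0 := ChainComplex.of_d X d 0
    rw [h]
    exact hε⟩
  quasiIso := ⟨fun n => by
    cases n
    -- In degree `0` the quasi-isomorphism condition is exactness of `X₁ → X₀ → Z → 0`.
    · rw [ChainComplex.quasiIsoAt₀_iff, ShortComplex.quasiIso_iff_of_zeros']
      · refine (ShortComplex.exact_and_epi_g_iff_of_iso ?_).2 ⟨eε, inferInstanceAs (Epi ε)⟩
        exact ShortComplex.isoMk (Iso.refl _) (Iso.refl _) (Iso.refl _)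
          ((Category.id_comp _).trans ((ChainComplex.of_d X d 0).symm.trans
            (Category.comp_id _).symm))
          ((Category.id_comp _).trans ((ChainComplex.toSingle₀Equiv_symm_apply_f_zero
            (C := ChainComplex.of X d hd) ε _).symm.trans (Category.comp_id _).symm))
      all_goals rfl
    · rename_i n
      -- In positive degrees the target complex is exact, so only exactness of the resolution itself
      -- is at stake.
      rw [quasiIsoAt_iff_exactAt']
      · rw [HomologicalComplex.exactAt_iff' _ (n + 1 + 1) (n + 1) n (by simp) (by simp)]
        refine (ShortComplex.exact_iff_of_iso ?_).2 (ed n)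
        exact ShortComplex.isoMk (Iso.refl _) (Iso.refl _) (Iso.refl _)
          ((Category.id_comp _).trans ((ChainComplex.of_d X d (n + 1)).symm.trans
            (Category.comp_id _).symm))
          ((Category.id_comp _).trans ((ChainComplex.of_d X d n).symm.trans
            (Category.comp_id _).symm))
      · apply ChainComplex.exactAt_succ_single_obj⟩

open CochainComplex.HomComplex in
-- There are no coboundaries in degree `0`, so a class vanishes only if its cocycle does. This
-- complements `extMk_eq_zero_iff`, which needs a preceding degree.
theorem extMk_zero_eq_zero_iff [HasExt.{w} C] {Z Y : C} (Q : ProjectiveResolution Z)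
    (f : Q.complex.X 0 ⟶ Y) (hf : Q.complex.d 1 0 ≫ f = 0) :
    Q.extMk f 1 rfl hf = 0 ↔ f = 0 := by
  constructor
  · intro h
    rw [← Q.extEquivCohomologyClass.apply_eq_iff_eq,
      ProjectiveResolution.extEquivCohomologyClass_extMk,
      ProjectiveResolution.extEquivCohomologyClass_zero, CohomologyClass.mk_eq_zero_iff,
      Cocycle.toSingleMk_mem_coboundaries_iff _ _ _ _ _ 1 (by simp)] at h
    obtain ⟨g, hg⟩ := h
    -- A bounding map `g` would start at cohomological degree `1`, where the resolution,
    -- concentrated in degrees at most `0`, is zero.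
    have hg0 : g = 0 :=
      (Q.cochainComplex.isZero_of_isStrictlyLE 0 1).eq_of_src _ _
    rw [hg0, Limits.comp_zero] at hg
    rw [← cancel_epi (Q.cochainComplexXIso (-((0 : ℕ) : ℤ)) 0 rfl).hom, Limits.comp_zero]
    exact hg.symm
  · rintro rfl
    exact Q.extMk_zero 1 rfl

/-- `Ext` is computed by a projective resolution. -/
theorem nonempty_seqCohomology_addEquiv_ext [HasExt.{w} C] {Z : C} (Q : ProjectiveResolution Z)
    (Y : C) (δ : ∀ n, (Q.complex.X n ⟶ Y) →+ (Q.complex.X (n + 1) ⟶ Y))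
    (hδ : ∀ n f, δ n f = Q.complex.d (n + 1) n ≫ f) (n : ℕ) :
    Nonempty (SeqCohomology δ n ≃+ Abelian.Ext.{w} Z Y n) := by
  have hc : ∀ c : (δ n).ker, Q.complex.d (n + 1) n ≫ (c : Q.complex.X n ⟶ Y) = 0 := fun c =>
    (hδ n c).symm.trans c.2
  refine nonempty_seqCohomology_addEquiv δ
    (AddMonoidHom.mk' (fun c => Q.extMk (c : Q.complex.X n ⟶ Y) (n + 1) rfl (hc c)) fun a b =>
      (Q.add_extMk _ _ _ rfl (hc a) (hc b)).symm) ?_ ?_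
  · intro y
    obtain ⟨f, hf, rfl⟩ := Q.extMk_surjective y (n + 1) rfl
    exact ⟨⟨f, (hδ n f).trans hf⟩, rfl⟩
  · intro c
    -- The split follows the convention for coboundaries: trivial in degree `0`, the range of the
    -- previous map otherwise.
    cases n with
    | zero => exact extMk_zero_eq_zero_iff Q _ (hc c)
    | succ n =>
      refine (Q.extMk_eq_zero_iff _ _ rfl (hc c) n rfl).trans (exists_congr fun g => ?_)
      rw [hδ]

end Ext

/-! ### The complex `Hom(R_•, A)` computes `Ext` -/

section Resolution

variable {G : Type u} [Group G] {S : Type u} [Monoid S] [IsInverseSemigroup S]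
  {π : ExelMonoid G →* S} {σ : S →* G}

instance (n : ℕ) : Projective (R π n) := inferInstanceAs (Projective (freeMod (V π n)))

/-- The cohomology of `Hom(R_•, A)` is `Ext_S(Z_S, A)`. -/
theorem nonempty_homCoboundary_cohomology_addEquiv (hπ : Function.Surjective π)
    (hσ : ∀ t, σ (π t) = ExelMonoid.toGroup t) (A : StrictMod S) (n : ℕ) :
    Nonempty (SeqCohomology (homCoboundary π A) n ≃+
      Abelian.Ext.{u + 1} (trivialMod S) A n) :=
  have : Epi (bdryZero π) := epi_of_surjective _ (Set.range_eq_univ.1 (image_bdryZero π))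
  nonempty_seqCohomology_addEquiv_ext
    (projectiveResolutionOfExact (R π) (bdry π) (bdryZero π) (bdry_comp_bdry hπ hσ)
      (bdry_comp_bdryZero hπ hσ)
      (fun n => exact_of_kernel_subset _ _ _ (kernel_bdry hπ hσ n).subset)
      (exact_of_kernel_subset _ _ _ (kernel_bdryZero hπ hσ).subset)) A (homCoboundary π A)
    (fun n f => congrArg (· ≫ f) (ChainComplex.of_d (R π) (bdry π) n).symm) n

end Resolution

/-! ### Change of the acting monoid along `ψ` -/

section Pullback

variable {S S' : Type u} [Monoid S] [IsInverseSemigroup S] [Monoid S'] [IsInverseSemigroup S']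

theorem Idem.map_conj (ψ : S →* S') (s : S) (e : Idem S) :
    Idem.map ψ (conj s e) = conj (ψ s) (Idem.map ψ e) := by
  ext
  rw [Idem.coe_map, coe_conj, map_mul, map_mul, map_sinv, coe_conj, Idem.coe_map]

/-- The strict `S`-module with components `A_{ψ(e)}`. -/
def pullbackComponents (ψ : S →* S') (A : StrictMod S') : Components S where
  X e := Additive (unitalIdeal (A.alpha (Idem.map ψ e)))ˣ
  act s _ _ h := MonoidHom.toAdditive (A.compMap (ψ s) (by rw [← Idem.map_conj, h]))
  act_idem {e f} h a := by
    apply Additive.toMul.injective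
    apply uval_injective
    change A.lam (ψ f) (uval (Additive.toMul a)) = uval (Additive.toMul a)
    have h1 : Idem.map ψ f * Idem.map ψ e = Idem.map ψ e := by
      rw [← map_mul, ← conj_idem, h]
    rw [← idem_mul_uval (Additive.toMul a), ← A.str.lam_idem, ← A.str.lam_mul]
    exact congrArg (fun i : Idem S' => A.lam i _) h1
  act_mul s t {e f g} _ _ _ a := by
    apply Additive.toMul.injective
    apply uval_injective
    change A.lam (ψ (s * t)) _ = A.lam (ψ s) (A.lam (ψ t) _)
    rw [map_mul, A.str.lam_mul]

/-- The canonical map from the module with components `A_{ψ(e)}` to `A`. -/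
def pullbackMap (ψ : S →* S') (A : StrictMod S') : (pullbackComponents ψ A).toStrictMod →ₙ* A where
  toFun := fun p : (pullbackComponents ψ A).Total => uval (Additive.toMul p.el)
  map_mul' := by
    rintro ⟨e, a⟩ ⟨f, b⟩
    change A.lam (Idem.map ψ f) (uval (Additive.toMul a)) *
      A.lam (Idem.map ψ e) (uval (Additive.toMul b)) =
        uval (Additive.toMul a) * uval (Additive.toMul b)
    rw [A.str.lam_idem, A.str.lam_idem, mul_mul_mul_comm, mul_comm (A.str.alpha _ : A),
      mul_mul_mul_comm]
    exact congrArg₂ (· * ·) (idem_mul_uval _) (idem_mul_uval _)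

section

variable (ψ : S →* S') {X : IdemSet S} {A : StrictMod S'} (φ : X.X → A)
  (hφ : ∀ t, A.deg (φ t) = Idem.map ψ (X.deg t))

/-- A map of sets compatible with `ψ : S → S'`, with values in the module with components
`A_{ψ(e)}`. -/
def toPullback (t : X.X) : (pullbackComponents ψ A).toStrictMod :=
  (pullbackComponents ψ A).toStrictModEl (e := X.deg t)
    (Additive.ofMul (toUnit (φ t) (A.deg_eq_iff.1 (hφ t))))

theorem pullbackMap_toPullback (t : X.X) : pullbackMap ψ A (toPullback ψ φ hφ t) = φ t := rfl

theorem deg_toPullback (t : X.X) :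
    (pullbackComponents ψ A).toStrictMod.deg (toPullback ψ φ hφ t) = X.deg t :=
  Components.deg_toStrictModEl _

theorem pullbackMap_alpha (e : Idem S) :
    pullbackMap ψ A ((pullbackComponents ψ A).toStrictMod.alpha e) = A.alpha (Idem.map ψ e) := rfl

theorem pullbackMap_lam (s : S) (a : (pullbackComponents ψ A).toStrictMod) :
    pullbackMap ψ A ((pullbackComponents ψ A).toStrictMod.lam s a) =
      A.lam (ψ s) (pullbackMap ψ A a) := rfl

/-- The map from a free module over `S` to a module over `S'` that extends a map `φ` of sets
compatible with `ψ : S → S'`. -/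
def freeLiftAlong : freeMod X →ₙ* A :=
  (pullbackMap ψ A).comp (Hom.app (freeLift (toPullback ψ φ hφ) (deg_toPullback ψ φ hφ)))

theorem freeLiftAlong_ι (t : X.X) : freeLiftAlong ψ φ hφ (freeι X t) = φ t := by
  rw [freeLiftAlong, MulHom.comp_apply, freeLift_ι, pullbackMap_toPullback]

theorem freeLiftAlong_alpha (e : Idem S) :
    freeLiftAlong ψ φ hφ ((freeMod X).alpha e) = A.alpha (Idem.map ψ e) := by
  rw [freeLiftAlong, MulHom.comp_apply, Hom.app_alpha, pullbackMap_alpha]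

theorem freeLiftAlong_lam (s : S) (a : freeMod X) :
    freeLiftAlong ψ φ hφ ((freeMod X).lam s a) = A.lam (ψ s) (freeLiftAlong ψ φ hφ a) := by
  rw [freeLiftAlong, MulHom.comp_apply, MulHom.comp_apply, Hom.app_lam, pullbackMap_lam]

end

/-- The target is a module over another monoid, so `freeMod_hom_ext` does not apply. The generation
argument still works, because semigroup homomorphisms between inverse semigroups preserve inverses.
-/
theorem freeMod_hom_ext_along (ψ : S →* S') {X : IdemSet S} {A : StrictMod S'}
    {g g' : freeMod X →ₙ* A} (hα : ∀ e, g ((freeMod X).alpha e) = g' ((freeMod X).alpha e))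
    (hg : ∀ s a, g ((freeMod X).lam s a) = A.lam (ψ s) (g a))
    (hg' : ∀ s a, g' ((freeMod X).lam s a) = A.lam (ψ s) (g' a))
    (hι : ∀ t, g (freeι X t) = g' (freeι X t)) : g = g' := by
  refine MulHom.ext fun a => ?_
  induction a using freeMod_induction with
  | hι s t => rw [hg, hg', hι]
  | hα e => exact hα e
  | hmul a b ha hb => rw [map_mul, map_mul, ha, hb]
  | hinv a ha => rw [map_sinv, map_sinv, ha]

end Pullback

/-! ### Freeness among epi-strict modules -/

section Freeness

variable {T : Type u} [Monoid T] [IsInverseSemigroup T]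

/-- The free module over an `E(S)`-set is free in the category of epi-strict modules. -/
theorem isFreeOn_freeMod (I : EpiImage T) (X : IdemSet I.S) :
    EpiStrictMod.IsFreeOn (F := ⟨I, freeMod X⟩) (X := ⟨I, X⟩)
      (⟨freeι X, MonoidHom.id _, rfl, fun t => deg_freeι X t⟩ :
        EpiStrictSet.Hom ⟨I, X⟩ (EpiStrictMod.toSet ⟨I, freeMod X⟩)) := by
  rintro A ⟨φ, ψ, hψ, hφ⟩
  change I.S →* A.img.S at ψ
  change X.X → A.mod at φ
  refine ⟨(⟨freeLiftAlong ψ φ hφ, ψ, hψ, freeLiftAlong_alpha ψ φ hφ,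
    freeLiftAlong_lam ψ φ hφ⟩ : EpiStrictMod.Hom ⟨I, freeMod X⟩ A), ?_, ?_⟩
  · exact EpiStrictSet.Hom.ext (funext (freeLiftAlong_ι ψ φ hφ)) (MonoidHom.comp_id _)
  · rintro ⟨g, ψ', hψ', hα, hlam⟩ h
    -- The monoid part of the embedding is the identity, so the factorization determines the monoid
    -- part of the extension.
    obtain rfl : ψ' = ψ := congrArg EpiStrictSet.Hom.ψ h
    have hι : ∀ t, g (freeι X t) = φ t := congrFun (congrArg EpiStrictSet.Hom.φ h)
    refine EpiStrictMod.Hom.ext (freeMod_hom_ext_along ψ' (fun e => ?_) hlam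
      (freeLiftAlong_lam ψ' φ hφ) fun t => ?_) rfl
    · exact (hα e).trans (freeLiftAlong_alpha ψ' φ hφ e).symm
    · exact (hι t).trans (freeLiftAlong_ι ψ' φ hφ t).symm

end Freeness

end PartialCohomology

end

/-! ### Assembly of the five statements -/

theorem mainTheorem2 {G : Type u} [Group G] (M : EpiStrictMod (ExelMonoid G))
    (hM : M.IsStandard) (P : PartialModule G M.mod) (hP : P.IsInverse) (hMP : M.Induces P) :
    -- every `R_n` is free over `V_n` among the inverse epi-strict modules
    (∀ n : ℕ, EpiStrictMod.IsFreeOn (resolutionι M.img n)) ∧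
    -- the sequence `⋯ → R_1 → R_0 → Z_S → 0` is exact
    ((∀ n : ℕ, StrictMod.Hom.kernel (bdry M.img.π n) =
        StrictMod.Hom.image (bdry M.img.π (n + 1))) ∧
      StrictMod.Hom.kernel (bdryZero M.img.π) = StrictMod.Hom.image (bdry M.img.π 0) ∧
      StrictMod.Hom.image (bdryZero M.img.π) = Set.univ) ∧
    -- restriction to `V_n` identifies the complex `Hom(R_•, A)` with the complex `C^•(G, A)`
    (∃ Φ : ∀ n : ℕ, (R M.img.π n ⟶ M.mod) ≃+ Additive (P.Cochain n),
      (∀ (n : ℕ) (f : R M.img.π n ⟶ M.mod) (x : Fin n → G),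
        uval (Additive.toMul (Φ n f) x) =
          StrictMod.Hom.app f (freeι (V M.img.π n) x)) ∧
      ∀ (n : ℕ) (f : R M.img.π n ⟶ M.mod),
        Φ (n + 1) (homCoboundary M.img.π M.mod n f) =
          MonoidHom.toAdditive (P.coboundary n) (Φ n f)) ∧
    -- the cohomology groups of `Hom(R_•, A)` are isomorphic to `Hⁿ(G, A)`
    (∀ n : ℕ, Nonempty (SeqCohomology (homCoboundary M.img.π M.mod) n ≃+ P.Cohomology n)) ∧
    -- `Hⁿ(G, A) ≅ Hⁿ(S(G), A) = Extⁿ_S(Z_S, A)`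
    ∀ n : ℕ, Nonempty (P.Cohomology n ≃+ M.Cohomology n) := by
  -- Standardness enters only here; from now on the grading `σ` and the surjectivity of `π` suffice
  -- for exactness.
  obtain ⟨σ, hσ⟩ := hM.exists_grading
  have hπ := M.img.surjective
  have h4 := nonempty_seqCohomology_congr (homCoboundary M.img.π M.mod)
    (fun n => MonoidHom.toAdditive (P.coboundary n)) (cochainEquiv hMP.1)
    (cochainEquiv_coboundary hMP.1 hMP.2)
  refine ⟨fun n => isFreeOn_freeMod M.img (V M.img.π n),
    ⟨kernel_bdry hπ hσ, kernel_bdryZero hπ hσ, image_bdryZero _⟩,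
    ⟨cochainEquiv hMP.1, fun _ _ _ => rfl, cochainEquiv_coboundary hMP.1 hMP.2⟩, h4, fun n => ?_⟩
  obtain ⟨e⟩ := h4 n
  obtain ⟨e'⟩ := nonempty_homCoboundary_cohomology_addEquiv hπ hσ M.mod n
  exact ⟨e.symm.trans e'⟩
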